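/- Let $M\subset B(H)$ be a von Neumann algebra with a faithful normal trace state $\tau$, let $1\in B\subset M$ be a W$^*$-subalgebra, let $X=X^*\in M$, and let $p\in M$ be a nonzero projection. Write $B\langle X\rangle$ for the algebra generated by $B$ and $X$, and $E_N$ for the unique trace preserving conditional expectation onto a W$^*$-subalgebra $N$. Assume: (i) $X$ and $p$ are $B$-free: every alternating product of elements of $B\langle X\rangle\cap\ker E_B$ and of $B\langle p\rangle\cap\ker E_B$ lies in $\ker E_B$; (ii) $p$ is independent from $B$ with respect to $\tau$: $p$ commutes with $B$ and $\tau(bp)=\tau(b)\tau(p)$ for all $b\in B$; (iii) $X$ is algebraically free from $B$, and the conjugate variable $\mathcal J(X:B)$ exists with $|\mathcal J(X:B)|_2<\infty$, i.e. there is $J\in L^2(W^*(B\langle X\rangle),\tau)$ such that $\tau(Jm)=(\tau\otimes\tau)(\partial_{X:B}m)$ for all $m\in B\langle X\rangle$, where $\partial_{X:B}:B\langle X\rangle\to B\langle X\rangle\otimes B\langle X\rangle$ is the derivation with $\partial_{X:B}(B)=0$ and $\partial_{X:B}(X)=1\otimes 1$. Put $\alpha=\tau(p)$ and $X_p=\alpha^{-1}pXp$.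 For a unital C$^*$-algebra $K$ let $\mathbb H_+(K)=\{T\in K:\operatorname{Im}T\ge\epsilon 1\text{ for some }\epsilon>0\}$. Then for every $n$ there is an analytic function $F_n:\mathbb H_+(\mathfrak M_n(B))\to\mathbb H_+(\mathfrak M_n(B))$ such that for all $\beta\in\mathbb H_+(\mathfrak M_n(B))$ the element $X_p\otimes I_n-\beta(p\otimes I_n)$ is invertible in $\mathfrak M_n(pMp)$, the element $X\otimes I_n-F_n(\beta)$ is invertible in $\mathfrak M_n(M)$, and $$\alpha^{-1}\,E_{\mathfrak M_n(W^*(B\langle X\rangle))}\Big(\big(X_p\otimes I_n-\beta(p\otimes I_n)\big)^{-1}\Big)=\big(X\otimes I_n-F_n(\beta)\big)^{-1},$$ where the first inverse is taken in $\mathfrak M_n(pMp)$, whose unit is $p\otimes I_n$, and the conditional expectation on $\mathfrak M_n(M)$ preserves the trace $\tau\otimes\operatorname{tr}_n$. -/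

import Mathlib

open scoped ComplexOrder InnerProductSpace TensorProduct ComplexStarModule

/-! ### Von Neumann algebras as C⋆-algebras -/

namespace VonNeumannAlgebra

variable {H : Type*} [NormedAddCommGroup H] [InnerProductSpace ℂ H] [CompleteSpace H]

instance instSMulMemClass : SMulMemClass (VonNeumannAlgebra H) ℂ (H →L[ℂ] H) where
  smul_mem {s} r _ hx := s.toStarSubalgebra.smul_mem hx r

instance instIsClosed (M : VonNeumannAlgebra H) : IsClosed (M : Set (H →L[ℂ] H)) := by
  rw [← M.centralizer_centralizer]
  exact Set.isClosed_centralizer _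

/-- The operator order inherited from `B(H)` makes a von Neumann algebra a star-ordered ring. -/
instance instStarOrderedRing (M : VonNeumannAlgebra H) : StarOrderedRing M := by
  refine StarOrderedRing.of_nonneg_iff'
    (fun h z => add_le_add_right (α := H →L[ℂ] H) h z.1) fun x => ⟨fun hx => ?_, ?_⟩
  · have hx' : (0 : H →L[ℂ] H) ≤ x := hx
    have hs : CFC.sqrt (x : H →L[ℂ] H) ∈ M := by
      rw [← SetLike.mem_coe, ← M.centralizer_centralizer]
      intro c hc
      have : Commute (x : H →L[ℂ] H) c := hc x x.2
      exact (this.cfcₙ_nnreal _).symm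
    refine ⟨⟨_, hs⟩, Subtype.ext ?_⟩
    change (x : H →L[ℂ] H) = star (CFC.sqrt (x : H →L[ℂ] H)) * CFC.sqrt (x : H →L[ℂ] H)
    rw [(CFC.sqrt_nonneg _).star_eq, CFC.sqrt_mul_sqrt_self _ hx']
  · rintro ⟨s, rfl⟩
    exact star_mul_self_nonneg (s : H →L[ℂ] H)

/-- `W*(S)`: the von Neumann algebra generated by a set `S` of operators, i.e. the double
commutant of `S ∪ S*`. -/
noncomputable def generated (S : Set (H →L[ℂ] H)) : VonNeumannAlgebra H where
  toStarSubalgebra := StarSubalgebra.centralizer ℂ (StarSubalgebra.centralizer ℂ S)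
  centralizer_centralizer' := by
    change Set.centralizer (Set.centralizer
      (StarSubalgebra.centralizer ℂ (StarSubalgebra.centralizer ℂ S : Set (H →L[ℂ] H)) :
        Set (H →L[ℂ] H))) = (StarSubalgebra.centralizer ℂ
          (StarSubalgebra.centralizer ℂ S : Set (H →L[ℂ] H)) : Set (H →L[ℂ] H))
    rw [StarSubalgebra.coe_centralizer_centralizer, Set.centralizer_centralizer_centralizer]

/-- The elements of `M` that belong to `N`, as a subalgebra of `M`. For `N ≤ M` this is `N`
itself, regarded inside `M`. -/
def within (N M : VonNeumannAlgebra H) : Subalgebra ℂ M where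
  carrier := {a | (a : H →L[ℂ] H) ∈ N}
  mul_mem' ha hb := mul_mem (S := VonNeumannAlgebra H) ha hb
  add_mem' ha hb := add_mem (S := VonNeumannAlgebra H) ha hb
  algebraMap_mem' r := N.toStarSubalgebra.algebraMap_mem r

/-- `τ` is a faithful normal trace state on `M` (positivity is part of the type of `τ`).
Normality is stated as: `τ` is a countable sum of vector functionals. -/
structure IsFaithfulNormalTraceState {M : VonNeumannAlgebra H} (τ : M →ₚ[ℂ] ℂ) : Prop where
  map_one : τ 1 = 1
  trace : ∀ a b : M, τ (a * b) = τ (b * a)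
  faithful : ∀ a : M, τ (star a * a) = 0 → a = 0
  normal : ∃ ξ : ℕ → H, Summable (fun k => ‖ξ k‖ ^ 2) ∧
    ∀ a : M, HasSum (fun k => ⟪ξ k, (a : H →L[ℂ] H) (ξ k)⟫_ℂ) (τ a)

end VonNeumannAlgebra

namespace FreeCompression

/-! ### Algebraic notions in a complex algebra `K` with a linear functional `φ` -/

section Algebraic

variable {K : Type*} [Ring K] [Algebra ℂ K]

/-- `A⟨X⟩`: the subalgebra generated by `A` and `X`. -/
def polys (A : Subalgebra ℂ K) (X : K) : Subalgebra ℂ K :=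
  Algebra.adjoin ℂ ((A : Set K) ∪ {X})

/-- The multilinear map `(a₀, a₁, …, a_k) ↦ a₀ X a₁ X ⋯ X a_k` on `A^(k+1)`. -/
noncomputable def word (A : Subalgebra ℂ K) (X : K) (k : ℕ) :
    MultilinearMap ℂ (fun _ : Fin (k + 1) => A) K :=
  (MultilinearMap.mkPiAlgebraFin ℂ (k + 1) K).compLinearMap
    (fun j => if j = 0 then A.val.toLinearMap
      else (LinearMap.mulLeft ℂ X) ∘ₗ A.val.toLinearMap)

/-- `X` is algebraically free from `A`: evaluation at `X` of the noncommutative polynomials with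
coefficients in `A` is injective. As a vector space, the algebra `A⟨t⟩` of noncommutative
polynomials (the coproduct of `A` and `ℂ[t]`) is `⨁ₖ A^{⊗(k+1)}`, where `a₀ ⊗ ⋯ ⊗ a_k` stands for
`a₀ t a₁ t ⋯ t a_k`. -/
def AlgebraicallyFree (A : Subalgebra ℂ K) (X : K) : Prop :=
  Function.Injective
    (DirectSum.toModule ℂ ℕ K (fun k => PiTensorProduct.lift (word A X k)) :
      (DirectSum ℕ fun k => ⨂[ℂ] _ : Fin (k + 1), A) →ₗ[ℂ] K)

theorem mem_polys_self (A : Subalgebra ℂ K) (X : K) : X ∈ polys A X :=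
  Algebra.subset_adjoin (Or.inr rfl)

/-- `D` is the free difference quotient `∂_{X:A} : A⟨X⟩ → A⟨X⟩ ⊗ A⟨X⟩`: the derivation that
vanishes on `A` and sends `X` to `1 ⊗ 1`. (Such a `D` is unique.) -/
structure IsFreeDifferenceQuotient (A : Subalgebra ℂ K) (X : K)
    (D : polys A X →ₗ[ℂ] polys A X ⊗[ℂ] polys A X) : Prop where
  leibniz : ∀ f g, D (f * g) = D f * ((1 : polys A X) ⊗ₜ[ℂ] g) + (f ⊗ₜ[ℂ] (1 : polys A X)) * D g
  coeff : ∀ f : polys A X, (f : K) ∈ A → D f = 0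
  map_var : D ⟨X, mem_polys_self A X⟩ = 1 ⊗ₜ[ℂ] 1

/-- The functional `φ ⊗ φ` on `S ⊗ S`. -/
noncomputable def tensorFunctional (φ : K →ₗ[ℂ] ℂ) (S : Subalgebra ℂ K) : S ⊗[ℂ] S →ₗ[ℂ] ℂ :=
  LinearMap.mul' ℂ ℂ ∘ₗ
    TensorProduct.map (φ ∘ₗ S.val.toLinearMap) (φ ∘ₗ S.val.toLinearMap)

/-- `y = E_N(a)`, where `E_N` is the `φ`-preserving conditional expectation onto `N`: it is the
element of `N` with `φ (y b) = φ (a b)` for every `b ∈ N`. -/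
def IsCondExp (φ : K →ₗ[ℂ] ℂ) (N : Set K) (a y : K) : Prop :=
  y ∈ N ∧ ∀ b ∈ N, φ (y * b) = φ (a * b)

/-- A `φ`-preserving map `E` onto `N` with `E (a b) = E a · b` for `b ∈ N` computes `IsCondExp`. -/
theorem IsCondExp.of_map {φ : K →ₗ[ℂ] ℂ} {N : Set K} (E : K → K) (hE : ∀ a, E a ∈ N)
    (hmul : ∀ a, ∀ b ∈ N, E (a * b) = E a * b) (hφ : ∀ a, φ (E a) = φ a) (a : K) :
    IsCondExp φ N a (E a) :=
  ⟨hE a, fun b hb => by rw [← hmul a b hb, hφ]⟩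

/-- For a faithful functional, `IsCondExp` determines the conditional expectation. -/
theorem IsCondExp.unique [StarRing K] {φ : K →ₗ[ℂ] ℂ} (hφ : ∀ a : K, φ (star a * a) = 0 → a = 0)
    (htr : ∀ a b : K, φ (a * b) = φ (b * a)) {N : Set K}
    (hsub : ∀ a ∈ N, ∀ b ∈ N, star (a - b) ∈ N) {a y z : K}
    (hy : IsCondExp φ N a y) (hz : IsCondExp φ N a z) : y = z := by
  refine sub_eq_zero.1 (hφ _ ?_)
  have hb := hsub y hy.1 z hz.1
  rw [htr, sub_mul, map_sub, hy.2 _ hb, hz.2 _ hb, sub_self]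

/-- Freeness of the family of subalgebras `S i` over `A`: every alternating product of elements
with vanishing conditional expectation onto `A` has vanishing conditional expectation onto `A`. -/
def IsFreeOver {ι : Type*} (φ : K →ₗ[ℂ] ℂ) (A : Subalgebra ℂ K) (S : ι → Subalgebra ℂ K) : Prop :=
  ∀ (k : ℕ) (i : Fin (k + 1) → ι) (a : Fin (k + 1) → K),
    (∀ j, a j ∈ S (i j)) → (∀ j : Fin k, i j.castSucc ≠ i j.succ) →
    (∀ j, IsCondExp φ A (a j) 0) → IsCondExp φ A (List.ofFn a).prod 0

/-- The elements `x` and `y` are `A`-free: `A⟨x⟩` and `A⟨y⟩` are free over `A`. -/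
def AreFreeOver (φ : K →ₗ[ℂ] ℂ) (A : Subalgebra ℂ K) (x y : K) : Prop :=
  IsFreeOver φ A ![polys A x, polys A y]

/-- `x` is (classically) independent from `A` with respect to `φ`: the algebras `ℂ[x]` and `A`
commute and `φ` is multiplicative on products of their elements. -/
def IsIndependentFrom (φ : K →ₗ[ℂ] ℂ) (A : Subalgebra ℂ K) (x : K) : Prop :=
  ∀ c ∈ Algebra.adjoin ℂ {x}, ∀ a ∈ A, Commute c a ∧ φ (a * c) = φ a * φ c

/-- For an idempotent `P`: `T` and `R` lie in the corner `P K P` and are inverse to each other in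
this algebra, whose unit is `P`. -/
structure IsCornerInverse (P T R : K) : Prop where
  left_mem : P * T * P = T
  right_mem : P * R * P = R
  mul_eq : T * R = P
  mul_eq' : R * T = P

end Algebraic

/-! ### Matrices and half-planes -/

/-- `x ⊗ I_n`. -/
def amplify {K : Type*} [Zero K] (n : ℕ) (x : K) : CStarMatrix (Fin n) (Fin n) K :=
  CStarMatrix.ofMatrix (Matrix.diagonal fun _ => x)

/-- The functional `φ ⊗ tr_n` on `n × n` matrices, with `tr_n` the normalized trace. -/
noncomputable def matrixFunctional {K : Type*} [Ring K] [Algebra ℂ K] (φ : K →ₗ[ℂ] ℂ) (n : ℕ) :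
    CStarMatrix (Fin n) (Fin n) K →ₗ[ℂ] ℂ where
  toFun T := (n : ℂ)⁻¹ * ∑ i, φ (T i i)
  map_add' S T := by simp [Finset.sum_add_distrib, mul_add]
  map_smul' r T := by simp [← Finset.mul_sum, mul_left_comm]

/-- `𝔐_n(N)`, the matrices with all entries in `N`. -/
def matricesOver {K : Type*} (n : ℕ) (N : Set K) : Set (CStarMatrix (Fin n) (Fin n) K) :=
  {T | ∀ i j, T i j ∈ N}

/-- The upper half-plane `ℍ₊(K)` of a unital C⋆-algebra: the elements `T` such that
`Im T ≥ ε 1` for some `ε > 0`. -/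
def upperHalfPlane (K : Type*) [CStarAlgebra K] [PartialOrder K] [StarOrderedRing K] : Set K :=
  {T | ∃ ε : ℝ, 0 < ε ∧ algebraMap ℝ K ε ≤ (ℑ T : K)}

/-! ### Conjugate variables -/

section Conjugate

variable {H : Type*} [NormedAddCommGroup H] [InnerProductSpace ℂ H] [CompleteSpace H]

/-- `W*(B⟨X⟩)`. -/
noncomputable def wstarPolys {M : VonNeumannAlgebra H} (B : VonNeumannAlgebra H) (X : M) :
    VonNeumannAlgebra H :=
  VonNeumannAlgebra.generated ((fun a : M => (a : H →L[ℂ] H)) '' polys (B.within M) X)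

/-- The canonical map of `M` into `L²(M, τ)`, the completion of `M` for `⟪a, b⟫ = τ (a* b)`. -/
noncomputable def toL2 {M : VonNeumannAlgebra H} (τ : M →ₚ[ℂ] ℂ) (a : M) : τ.GNS :=
  ((τ.toPreGNS a : τ.PreGNS) : UniformSpace.Completion τ.PreGNS)

/-- `X` is algebraically free from `B`, and `J` is the conjugate variable `𝒥(X:B)`, lying in
`L²(W*(B⟨X⟩))` (the closure of `W*(B⟨X⟩)` in `L²(M, τ)`):
`τ (J m) = (τ ⊗ τ) (∂_{X:B} m)` for every `m ∈ B⟨X⟩`. Here `τ (J m)` is `⟪m*, J⟫`. -/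
def IsL2ConjugateVariable {M : VonNeumannAlgebra H} (τ : M →ₚ[ℂ] ℂ) (B : VonNeumannAlgebra H)
    (X : M) (J : τ.GNS) : Prop :=
  AlgebraicallyFree (B.within M) X ∧
  J ∈ closure (toL2 τ '' ((wstarPolys B X).within M : Set M)) ∧
  ∃ D : polys (B.within M) X →ₗ[ℂ] polys (B.within M) X ⊗[ℂ] polys (B.within M) X,
    IsFreeDifferenceQuotient (B.within M) X D ∧
    ∀ m : polys (B.within M) X,
      ⟪toL2 τ (star (m : M)), J⟫_ℂ =
        tensorFunctional τ.toLinearMap (polys (B.within M) X) (D m)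

end Conjugate

end FreeCompression

open FreeCompression

open scoped Ring

/-!
Write `R` for the inverse of `X_p - β p` in the corner and `h(β) = α⁻¹ E_B(R)`. The subordination
function is `F(β) = α β - (1 - α) h(β)⁻¹`. It takes values in the half-plane because the positive
map `E_B` carries `R` into the half-plane, where `h ↦ -h⁻¹` acts.

To see that `α⁻¹ E(R) = (X - F(β))⁻¹`, parametrize by `ω = F(β)`. Put `S = (X - ω)⁻¹`,
`v = E_B(S)⁻¹ S - 1` and `β = α⁻¹ (ω + (1 - α) E_B(S)⁻¹)`. Then
`α⁻¹ R = S (α - (p - α) v)⁻¹ p`, and if `v` is small, the right side expands into alternating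
products of `p - α` and `v`, which are both centered over `B`. By freeness, `α⁻¹ R - S` is
orthogonal to `B⟨X⟩`. For `X` close to `0`, the implicit function theorem produces `ω` from `β`;
both sides are analytic in `z` along the segment `z X`, so the identity extends to `z = 1`.
-/

namespace FreeCompression

/-! ### Half-planes in C⋆-algebras -/

section HalfPlane

variable {K : Type*} [CStarAlgebra K]

theorem coe_imaginaryPart_conj (c T : K) : (ℑ (c * T * star c) : K) = c * (ℑ T : K) * star c := by
  simp only [imaginaryPart_apply_coe, star_mul, star_star, mul_smul_comm, smul_mul_assoc, mul_sub,
    sub_mul, mul_assoc]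

theorem coe_imaginaryPart_neg_inverse {T : K} (hT : IsUnit T) :
    (ℑ (-T⁻¹ʳ) : K) = T⁻¹ʳ * (ℑ T : K) * star T⁻¹ʳ := by
  have hinv : -T⁻¹ʳ = T⁻¹ʳ * (-star T) * star T⁻¹ʳ := by
    rw [mul_neg, neg_mul, mul_assoc, ← star_mul, Ring.inverse_mul_cancel T hT, star_one, mul_one]
  rw [hinv, coe_imaginaryPart_conj]
  simp only [imaginaryPart_apply_coe, star_neg, star_star, sub_neg_eq_add, neg_add_eq_sub]

variable [PartialOrder K] [StarOrderedRing K]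

theorem norm_one_add_I_smul_lt_one {T : K} {ε t : ℝ} (hT : algebraMap ℝ K ε ≤ (ℑ T : K))
    (ht : 0 < t) (htε : t * ‖T‖ ^ 2 < 2 * ε) : ‖1 + (t * Complex.I) • T‖ < 1 := by
  set A : K := 1 + (t * Complex.I) • T with hA
  have hexpand : star A * A = 1 - (2 * t) • (ℑ T : K) + t ^ 2 • (star T * T) := by
    simp only [hA, imaginaryPart_apply_coe, star_add, star_one, star_smul, add_mul, mul_add,
      one_mul, mul_one, smul_mul_smul_comm]
    simp only [← Complex.coe_smul, star_mul', Complex.star_def, Complex.conj_I, Complex.conj_ofReal,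
      smul_sub, smul_smul]
    match_scalars <;> ring_nf
    simp only [Complex.I_sq]
    ring
  have hle : star A * A ≤ algebraMap ℝ K (1 - t * (2 * ε - t * ‖T‖ ^ 2)) := by
    have h₁ := smul_le_smul_of_nonneg_left hT (by positivity : 0 ≤ 2 * t)
    have h₂ := smul_le_smul_of_nonneg_left
      (CStarAlgebra.star_mul_le_algebraMap_norm_sq (a := T)) (by positivity : 0 ≤ t ^ 2)
    calc star A * A ≤ 1 - (2 * t) • algebraMap ℝ K ε + t ^ 2 • algebraMap ℝ K (‖T‖ ^ 2) := by
          rw [hexpand]; gcongr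
      _ = _ := by simp only [Algebra.algebraMap_eq_smul_one]; module
  have hsq : ‖A‖ * ‖A‖ ≤ max 0 (1 - t * (2 * ε - t * ‖T‖ ^ 2)) := by
    rw [← CStarRing.norm_star_mul_self,
      CStarAlgebra.norm_le_iff_le_algebraMap _ (le_max_left _ _) (star_mul_self_nonneg A)]
    exact hle.trans (algebraMap_mono K (le_max_right _ _))
  have hlt : ‖A‖ * ‖A‖ < 1 :=
    hsq.trans_lt (max_lt one_pos (sub_lt_self 1 (mul_pos ht (sub_pos.2 htε))))
  nlinarith [norm_nonneg A]

theorem isUnit_of_mem_upperHalfPlane {T : K} (hT : T ∈ upperHalfPlane K) : IsUnit T := by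
  obtain ⟨ε, hε, h⟩ := hT
  have ht : 0 < ε / (‖T‖ ^ 2 + 1) := by positivity
  have hlt : ‖1 + ((ε / (‖T‖ ^ 2 + 1) : ℝ) * Complex.I) • T‖ < 1 := by
    refine norm_one_add_I_smul_lt_one h ht ?_
    rw [div_mul_eq_mul_div, div_lt_iff₀ (by positivity)]
    nlinarith [sq_nonneg ‖T‖]
  have hu := isUnit_one_sub_of_norm_lt_one hlt
  rw [sub_add_cancel_left, IsUnit.neg_iff] at hu
  exact (isUnit_smul_iff (Units.mk0 _ (mul_ne_zero (Complex.ofReal_ne_zero.2 ht.ne')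
    Complex.I_ne_zero)) T).1 hu

theorem neg_inverse_mem_upperHalfPlane {T : K} (hT : T ∈ upperHalfPlane K) :
    -T⁻¹ʳ ∈ upperHalfPlane K := by
  have hu := isUnit_of_mem_upperHalfPlane hT
  obtain ⟨ε, hε, h⟩ := hT
  have hN : (0 : ℝ) < ‖T‖ ^ 2 + 1 := by positivity
  refine ⟨ε * (‖T‖ ^ 2 + 1)⁻¹, by positivity, ?_⟩
  rw [coe_imaginaryPart_neg_inverse hu]
  have hnorm : T * star T ≤ algebraMap ℝ K (‖T‖ ^ 2 + 1) :=
    CStarAlgebra.mul_star_le_algebraMap_norm_sq.trans (algebraMap_mono K (by linarith))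
  have hone : 1 ≤ (‖T‖ ^ 2 + 1) • (T⁻¹ʳ * star T⁻¹ʳ) := by
    calc (1 : K) = T⁻¹ʳ * (T * star T) * star T⁻¹ʳ := by
          rw [Ring.inverse_mul_cancel_left _ _ hu, ← star_mul, Ring.inverse_mul_cancel T hu,
            star_one]
      _ ≤ _ := star_right_conjugate_le_conjugate hnorm T⁻¹ʳ
      _ = _ := by simp [Algebra.algebraMap_eq_smul_one]
  calc algebraMap ℝ K (ε * (‖T‖ ^ 2 + 1)⁻¹)
      ≤ (ε * (‖T‖ ^ 2 + 1)⁻¹) • ((‖T‖ ^ 2 + 1) • (T⁻¹ʳ * star T⁻¹ʳ)) := by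
        rw [Algebra.algebraMap_eq_smul_one]
        exact smul_le_smul_of_nonneg_left hone (by positivity)
    _ = T⁻¹ʳ * algebraMap ℝ K ε * star T⁻¹ʳ := by
        rw [smul_smul, inv_mul_cancel_right₀ hN.ne']; simp [Algebra.algebraMap_eq_smul_one]
    _ ≤ _ := star_right_conjugate_le_conjugate h _

theorem pos_combination_mem_upperHalfPlane {S T : K} (hS : S ∈ upperHalfPlane K)
    (hT : T ∈ upperHalfPlane K) {s t : ℝ} (hs : 0 < s) (ht : 0 ≤ t) :
    (s : ℂ) • S + (t : ℂ) • T ∈ upperHalfPlane K := by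
  obtain ⟨ε, hε, h⟩ := hS
  obtain ⟨δ, hδ, h'⟩ := hT
  refine ⟨s * ε + t * δ, by positivity, ?_⟩
  have := add_le_add (smul_le_smul_of_nonneg_left h hs.le) (smul_le_smul_of_nonneg_left h' ht)
  simpa [map_add, Algebra.algebraMap_eq_smul_one, add_smul, mul_smul, Complex.coe_smul] using this

theorem map_mem_upperHalfPlane {L : Type*} [CStarAlgebra L] [PartialOrder L] [StarOrderedRing L]
    (ι : K →⋆ₐ[ℂ] L) {T : K} (hT : T ∈ upperHalfPlane K) : ι T ∈ upperHalfPlane L := by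
  obtain ⟨ε, hε, h⟩ := hT
  refine ⟨ε, hε, ?_⟩
  have hmono := OrderHomClass.mono ι h
  rwa [map_imaginaryPart, Algebra.algebraMap_eq_smul_one, ← Complex.coe_smul, map_smul, map_one,
    Complex.coe_smul, ← Algebra.algebraMap_eq_smul_one] at hmono

theorem isUnit_sub_of_mem_upperHalfPlane {X T : K} (hX : IsSelfAdjoint X)
    (hT : T ∈ upperHalfPlane K) : IsUnit (X - T) := by
  obtain ⟨ε, hε, h⟩ := hT
  rw [← IsUnit.neg_iff, neg_sub]
  refine isUnit_of_mem_upperHalfPlane ⟨ε, hε, ?_⟩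
  rwa [map_sub, hX.imaginaryPart, sub_zero]

end HalfPlane

/-! ### Inverses -/

section Inverse

theorem ringInverse_eq_of_mul_eq_one {A : Type*} [MonoidWithZero A] {a b : A} (hab : a * b = 1)
    (hba : b * a = 1) : a⁻¹ʳ = b :=
  Ring.inverse_unit ⟨a, b, hab, hba⟩

theorem commute_ringInverse_right {A : Type*} [MonoidWithZero A] {a b : A} (h : Commute a b) :
    Commute a b⁻¹ʳ := by
  by_cases hb : IsUnit b
  · obtain ⟨u, rfl⟩ := hb
    rw [Ring.inverse_unit]
    exact h.units_inv_right
  · rw [Ring.inverse_non_unit _ hb]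
    exact Commute.zero_right a

theorem isUnit_smul_one_sub {𝕜 A : Type*} [Field 𝕜] [NormedRing A] [HasSummableGeomSeries A]
    [Algebra 𝕜 A] {c : 𝕜} (hc : c ≠ 0) {a : A} (ha : ‖c⁻¹ • a‖ < 1) : IsUnit (c • 1 - a) := by
  have := (isUnit_one_sub_of_norm_lt_one ha).smul (Units.mk0 c hc)
  rwa [Units.smul_mk0, smul_sub, smul_inv_smul₀ hc] at this

theorem ringInverse_mem {A : Type*} [CStarAlgebra A] {S : StarSubalgebra ℂ A}
    (hS : IsClosed (S : Set A)) {a : A} (ha : a ∈ S) : a⁻¹ʳ ∈ S := by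
  by_cases hu : IsUnit a
  · have := hS
    obtain ⟨u, hu'⟩ := S.coe_isUnit.1 (show IsUnit ((⟨a, ha⟩ : S) : A) from hu)
    rw [show a = ((Units.map S.subtype.toMonoidHom u : Aˣ) : A) from congrArg Subtype.val hu'.symm,
      Ring.inverse_unit]
    exact (↑u⁻¹ : S).2
  · rw [Ring.inverse_non_unit _ hu]
    exact zero_mem S

theorem analyticAt_ringInverse_comp {𝕜 V A : Type*} [NontriviallyNormedField 𝕜]
    [NormedAddCommGroup V] [NormedSpace 𝕜 V] [NormedRing A] [NormedAlgebra 𝕜 A]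
    [HasSummableGeomSeries A] {f : V → A} {x : V} (hf : AnalyticAt 𝕜 f x) (hu : IsUnit (f x)) :
    AnalyticAt 𝕜 (fun y => (f y)⁻¹ʳ) x := by
  obtain ⟨u, hu⟩ := hu
  exact (hu ▸ analyticAt_inverse u : AnalyticAt 𝕜 Ring.inverse (f x)).comp hf

end Inverse

/-! ### Tracial conditional expectations -/

section CondExp

variable {𝔐 𝔅 : Type*} [CStarAlgebra 𝔐] [PartialOrder 𝔐] [CStarAlgebra 𝔅]

/-- `E` is the conditional expectation of `𝔐` onto the subalgebra `ι 𝔅` that preserves the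
positive trace `τ`, which is faithful on `ι 𝔅`. Only linearity of `E` is assumed: positivity and
continuity follow from `trace_condExp_mul`. -/
structure IsTracialCondExp (ι : 𝔅 →⋆ₐ[ℂ] 𝔐) (τ : 𝔐 →ₚ[ℂ] ℂ) (E : 𝔐 →ₗ[ℂ] 𝔅) : Prop where
  trace_comm : ∀ a b, τ (a * b) = τ (b * a)
  faithful : ∀ b : 𝔅, τ (ι (star b * b)) = 0 → b = 0
  trace_condExp_mul : ∀ a b, τ (ι (E a) * ι b) = τ (a * ι b)

theorem trace_mul_nonneg [StarOrderedRing 𝔐] {τ : 𝔐 →ₚ[ℂ] ℂ}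
    (hτ : ∀ a b, τ (a * b) = τ (b * a)) {a b : 𝔐} (ha : 0 ≤ a) (hb : 0 ≤ b) : 0 ≤ τ (a * b) := by
  obtain ⟨s, rfl⟩ := CStarAlgebra.nonneg_iff_eq_star_mul_self.1 hb
  rw [← mul_assoc, hτ, ← mul_assoc]
  exact map_nonneg τ (star_right_conjugate_nonneg ha s)

namespace IsTracialCondExp

variable {ι : 𝔅 →⋆ₐ[ℂ] 𝔐} {τ : 𝔐 →ₚ[ℂ] ℂ} {E : 𝔐 →ₗ[ℂ] 𝔅}

theorem condExp_eq (hE : IsTracialCondExp ι τ E) {a : 𝔐} {y : 𝔅}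
    (h : ∀ b, τ (a * ι b) = τ (ι y * ι b)) : E a = y := by
  refine sub_eq_zero.1 (hE.faithful _ ?_)
  rw [map_mul, hE.trace_comm, map_sub, sub_mul, map_sub, hE.trace_condExp_mul, h, sub_self]

theorem condExp_map (hE : IsTracialCondExp ι τ E) (b : 𝔅) : E (ι b) = b :=
  hE.condExp_eq fun _ => rfl

theorem condExp_one (hE : IsTracialCondExp ι τ E) : E 1 = 1 := by
  simpa only [map_one] using hE.condExp_map 1

theorem condExp_mul_left (hE : IsTracialCondExp ι τ E) (b : 𝔅) (a : 𝔐) :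
    E (ι b * a) = b * E a := by
  refine hE.condExp_eq fun d => ?_
  calc τ (ι b * a * ι d) = τ (a * ι (d * b)) := by
        rw [mul_assoc, hE.trace_comm, mul_assoc, ← map_mul ι]
    _ = τ (ι (E a) * ι (d * b)) := (hE.trace_condExp_mul a _).symm
    _ = τ (ι (b * E a) * ι d) := by
        rw [map_mul ι, map_mul ι, ← mul_assoc, hE.trace_comm, ← mul_assoc]

variable [StarOrderedRing 𝔐]

theorem condExp_star (hE : IsTracialCondExp ι τ E) (a : 𝔐) : E (star a) = star (E a) := by
  refine hE.condExp_eq fun b => ?_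
  calc τ (star a * ι b) = star (τ (a * ι (star b))) := by
        rw [← map_star, star_mul, hE.trace_comm, ← map_star ι, star_star]
    _ = τ (ι (star (E a)) * ι b) := by
        rw [← hE.trace_condExp_mul, ← map_star, star_mul, hE.trace_comm, ← map_star ι, ← map_star ι,
          star_star]

theorem coe_imaginaryPart_condExp (hE : IsTracialCondExp ι τ E) (a : 𝔐) :
    (ℑ (E a) : 𝔅) = E (ℑ a : 𝔐) := by
  simp only [imaginaryPart_apply_coe, ← hE.condExp_star, ← map_sub, ← Complex.coe_smul, ← map_smul]

variable [PartialOrder 𝔅] [StarOrderedRing 𝔅]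

theorem condExp_nonneg (hE : IsTracialCondExp ι τ E) {a : 𝔐} (ha : 0 ≤ a) : 0 ≤ E a := by
  have hsa : IsSelfAdjoint (E a) := by
    rw [isSelfAdjoint_iff, ← hE.condExp_star, ha.isSelfAdjoint.star_eq]
  have hneg : 0 ≤ (E a)⁻ := CFC.negPart_nonneg (E a)
  have hmul : E a * (E a)⁻ = -(star (E a)⁻ * (E a)⁻) := by
    nth_rewrite 1 [← CFC.posPart_sub_negPart (E a)]
    rw [sub_mul, CFC.posPart_mul_negPart, zero_sub, hneg.isSelfAdjoint.star_eq]
  have hle : 0 ≤ -τ (ι (star (E a)⁻ * (E a)⁻)) := by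
    rw [← map_neg, ← map_neg, ← hmul, map_mul, hE.trace_condExp_mul]
    exact trace_mul_nonneg hE.trace_comm ha (map_nonneg ι hneg)
  have hge : 0 ≤ τ (ι (star (E a)⁻ * (E a)⁻)) :=
    map_nonneg τ (map_nonneg ι (star_mul_self_nonneg _))
  rw [← CFC.negPart_eq_zero_iff (E a)]
  exact hE.faithful _ (le_antisymm (neg_nonneg.1 hle) hge)

theorem condExp_mono (hE : IsTracialCondExp ι τ E) : Monotone E :=
  (PositiveLinearMap.mk₀ E fun _ => hE.condExp_nonneg).monotone'

theorem continuous_condExp (hE : IsTracialCondExp ι τ E) : Continuous E :=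
  map_continuous (PositiveLinearMap.mk₀ E fun _ => hE.condExp_nonneg)

end IsTracialCondExp

end CondExp

/-! ### The corner resolvent and the subordination function -/

section Corner

variable {𝔐 𝔅 : Type*} [CStarAlgebra 𝔐] [CStarAlgebra 𝔅]

section Definitions

variable (ι : 𝔅 →⋆ₐ[ℂ] 𝔐) (E : 𝔐 →ₗ[ℂ] 𝔅) (P : 𝔐) (α : ℝ)

/-- `α⁻¹ P X P - β P`, made invertible on the complement of `P`. -/
noncomputable def cornerShift (X : 𝔐) (β : 𝔅) : 𝔐 :=
  (α : ℂ)⁻¹ • (P * X * P) - ι β * P - Complex.I • (1 - P)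

/-- The inverse of `α⁻¹ P X P - β P` in the corner `P 𝔐 P`. -/
noncomputable def cornerResolvent (X : 𝔐) (β : 𝔅) : 𝔐 :=
  (cornerShift ι P α X β)⁻¹ʳ * P

/-- The `𝔅`-valued Cauchy transform (up to sign) of the compression of `X`. -/
noncomputable def cornerCauchy (X : 𝔐) (β : 𝔅) : 𝔅 :=
  (α : ℂ)⁻¹ • E (cornerResolvent ι P α X β)

/-- The subordination function of the compression. -/
noncomputable def subordination (X : 𝔐) (β : 𝔅) : 𝔅 :=
  (α : ℂ) • β + ((1 - α : ℝ) : ℂ) • -(cornerCauchy ι E P α X β)⁻¹ʳ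

/-- The resolvent of `X` at the value of the subordination function. -/
noncomputable def subordinateResolvent (X : 𝔐) (β : 𝔅) : 𝔐 :=
  (X - ι (subordination ι E P α X β))⁻¹ʳ

end Definitions

section Shift

variable {ι : 𝔅 →⋆ₐ[ℂ] 𝔐} {P : 𝔐}

theorem commute_cornerShift (hP : IsIdempotentElem P) (hcomm : ∀ b, Commute P (ι b)) (α : ℝ)
    (X : 𝔐) (β : 𝔅) : Commute P (cornerShift ι P α X β) := by
  simp only [commute_iff_eq, cornerShift, mul_sub, sub_mul, mul_smul_comm, smul_mul_assoc,
    mul_assoc, hP.eq, hP.mul_self_mul, mul_one, one_mul, (hcomm β).left_comm]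

theorem cornerShift_mul (hP : IsIdempotentElem P) (α : ℝ) (X : 𝔐) (β : 𝔅) :
    cornerShift ι P α X β * P = (α : ℂ)⁻¹ • (P * X * P) - ι β * P := by
  simp only [cornerShift, sub_mul, smul_mul_assoc, mul_assoc, hP.eq, one_mul, sub_self, smul_zero,
    sub_zero]

theorem isCornerInverse_mul {K : Type*} [Ring K] {P T R : K} (hP : IsIdempotentElem P)
    (hT : Commute P T) (hR : Commute P R) (hTR : T * R = 1) (hRT : R * T = 1) :
    IsCornerInverse P (T * P) (R * P) where
  left_mem := by rw [← mul_assoc, hT.eq, mul_assoc _ P P, hP.eq, mul_assoc, hP.eq]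
  right_mem := by rw [← mul_assoc, hR.eq, mul_assoc _ P P, hP.eq, mul_assoc, hP.eq]
  mul_eq := by rw [mul_assoc, ← mul_assoc P, hR.eq, mul_assoc R, hP.eq, ← mul_assoc, hTR, one_mul]
  mul_eq' := by rw [mul_assoc, ← mul_assoc P, hT.eq, mul_assoc T, hP.eq, ← mul_assoc, hRT, one_mul]

theorem coe_imaginaryPart_neg_cornerShift (hP : IsStarProjection P)
    (hcomm : ∀ b, Commute P (ι b)) (α : ℝ) {X : 𝔐} (hX : IsSelfAdjoint X) (β : 𝔅) :
    (ℑ (-cornerShift ι P α X β) : 𝔐) = P * (ℑ (ι β) : 𝔐) * star P + (1 - P) := by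
  have hcompression : ℑ ((α : ℂ)⁻¹ • (P * X * P)) = 0 := by
    rw [← Complex.ofReal_inv, Complex.coe_smul]
    have hPXP := hX.conjugate P
    rw [hP.isSelfAdjoint.star_eq] at hPXP
    exact ((IsSelfAdjoint.all (α⁻¹ : ℝ)).smul hPXP).imaginaryPart
  have hcomplement : (ℑ (Complex.I • (1 - P)) : 𝔐) = 1 - P := by
    rw [imaginaryPart_I_smul]
    exact hP.one_sub.isSelfAdjoint.coe_realPart
  have hcorner : ι β * P = P * ι β * star P := by
    rw [hP.isSelfAdjoint.star_eq, (hcomm β).eq, mul_assoc, hP.isIdempotentElem.eq]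
  rw [cornerShift, map_neg, map_sub, map_sub, hcompression, hcorner]
  push_cast
  rw [coe_imaginaryPart_conj, hcomplement]
  abel

variable [PartialOrder 𝔐] [StarOrderedRing 𝔐] [PartialOrder 𝔅] [StarOrderedRing 𝔅]

theorem neg_cornerShift_mem_upperHalfPlane (hP : IsStarProjection P)
    (hcomm : ∀ b, Commute P (ι b)) (α : ℝ) {X : 𝔐} (hX : IsSelfAdjoint X) {β : 𝔅}
    (hβ : β ∈ upperHalfPlane 𝔅) : -cornerShift ι P α X β ∈ upperHalfPlane 𝔐 := by
  obtain ⟨ε, hε, h⟩ := map_mem_upperHalfPlane ι hβ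
  refine ⟨min ε 1, by positivity, ?_⟩
  calc algebraMap ℝ 𝔐 (min ε 1) = (min ε 1) • P + (min ε 1) • (1 - P) := by
        rw [← smul_add, add_sub_cancel, Algebra.algebraMap_eq_smul_one]
    _ ≤ ε • P + (1 : ℝ) • (1 - P) :=
        add_le_add (smul_le_smul_of_nonneg_right (min_le_left _ _) hP.nonneg)
          (smul_le_smul_of_nonneg_right (min_le_right _ _) hP.one_sub.nonneg)
    _ = P * algebraMap ℝ 𝔐 ε * star P + (1 - P) := by
        rw [hP.isSelfAdjoint.star_eq, Algebra.algebraMap_eq_smul_one, mul_smul_comm,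
          smul_mul_assoc, mul_one, hP.isIdempotentElem.eq, one_smul]
    _ ≤ P * (ℑ (ι β) : 𝔐) * star P + (1 - P) := by
        gcongr
        exact star_right_conjugate_le_conjugate h P
    _ = _ := (coe_imaginaryPart_neg_cornerShift hP hcomm α hX β).symm

theorem isUnit_cornerShift (hP : IsStarProjection P) (hcomm : ∀ b, Commute P (ι b)) (α : ℝ)
    {X : 𝔐} (hX : IsSelfAdjoint X) {β : 𝔅} (hβ : β ∈ upperHalfPlane 𝔅) :
    IsUnit (cornerShift ι P α X β) :=
  (IsUnit.neg_iff _).1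
    (isUnit_of_mem_upperHalfPlane (neg_cornerShift_mem_upperHalfPlane hP hcomm α hX hβ))

theorem isCornerInverse_cornerResolvent (hP : IsStarProjection P) (hcomm : ∀ b, Commute P (ι b))
    (α : ℝ) {X : 𝔐} (hX : IsSelfAdjoint X) {β : 𝔅} (hβ : β ∈ upperHalfPlane 𝔅) :
    IsCornerInverse P ((α : ℂ)⁻¹ • (P * X * P) - ι β * P) (cornerResolvent ι P α X β) := by
  have hu := isUnit_cornerShift hP hcomm α hX hβ
  have hcommShift := commute_cornerShift hP.isIdempotentElem hcomm α X β
  rw [← cornerShift_mul hP.isIdempotentElem]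
  exact isCornerInverse_mul hP.isIdempotentElem hcommShift (commute_ringInverse_right hcommShift)
    (Ring.mul_inverse_cancel _ hu) (Ring.inverse_mul_cancel _ hu)

theorem analyticAt_cornerResolvent (hP : IsStarProjection P) (hcomm : ∀ b, Commute P (ι b))
    (α : ℝ) {X : 𝔐} (hX : IsSelfAdjoint X) {β : 𝔅} (hβ : β ∈ upperHalfPlane 𝔅) :
    AnalyticAt ℂ (fun x : 𝔐 × 𝔅 => cornerResolvent ι P α x.1 x.2) (X, β) := by
  have hι : AnalyticAt ℂ (fun x : 𝔐 × 𝔅 => ι x.2) (X, β) :=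
    ((⟨ι.toLinearMap, map_continuous ι⟩ : 𝔅 →L[ℂ] 𝔐).analyticAt β).comp analyticAt_snd
  have hcompression : AnalyticAt ℂ (fun x : 𝔐 × 𝔅 => P * x.1 * P) (X, β) :=
    (analyticAt_const.mul analyticAt_fst).mul analyticAt_const
  exact (analyticAt_ringInverse_comp (f := fun x : 𝔐 × 𝔅 => cornerShift ι P α x.1 x.2)
    (((hcompression.const_smul (c := (α : ℂ)⁻¹)).sub (hι.mul analyticAt_const)).sub
      analyticAt_const) (isUnit_cornerShift hP hcomm α hX hβ)).mul analyticAt_const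

end Shift

end Corner

section Independent

variable {𝔐 𝔅 : Type*} [CStarAlgebra 𝔐] [CStarAlgebra 𝔅] [PartialOrder 𝔐]

/-- `P` is a nonzero projection of trace `α` that commutes with `ι 𝔅` and is independent from it
with respect to `τ`. -/
structure IsIndependentProjection (ι : 𝔅 →⋆ₐ[ℂ] 𝔐) (τ : 𝔐 →ₚ[ℂ] ℂ) (P : 𝔐) (α : ℝ) : Prop where
  isStarProjection : IsStarProjection P
  commute : ∀ b, Commute P (ι b)
  trace_mul : ∀ b, τ (P * ι b) = α * τ (ι b)
  pos : 0 < α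
  le_one : α ≤ 1

variable {ι : 𝔅 →⋆ₐ[ℂ] 𝔐} {τ : 𝔐 →ₚ[ℂ] ℂ} {E : 𝔐 →ₗ[ℂ] 𝔅} {P : 𝔐} {α : ℝ}

theorem IsTracialCondExp.condExp_proj (hE : IsTracialCondExp ι τ E)
    (hP : IsIndependentProjection ι τ P α) : E P = (α : ℂ) • 1 :=
  hE.condExp_eq fun b => by
    rw [hP.trace_mul, map_smul, map_one, smul_mul_assoc, one_mul, map_smul, smul_eq_mul]

variable [StarOrderedRing 𝔐] [PartialOrder 𝔅] [StarOrderedRing 𝔅]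

theorem exists_smul_le_imaginaryPart_cornerResolvent (hP : IsIndependentProjection ι τ P α)
    {X : 𝔐} (hX : IsSelfAdjoint X) {β : 𝔅} (hβ : β ∈ upperHalfPlane 𝔅) :
    ∃ c : ℝ, 0 < c ∧ c • P ≤ (ℑ (cornerResolvent ι P α X β) : 𝔐) := by
  have hproj := hP.isStarProjection
  obtain ⟨c, hc, h⟩ := neg_inverse_mem_upperHalfPlane
    (neg_cornerShift_mem_upperHalfPlane hproj hP.commute α hX hβ)
  have hneg : -(-cornerShift ι P α X β)⁻¹ʳ = (cornerShift ι P α X β)⁻¹ʳ := by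
    obtain ⟨u, hu⟩ := isUnit_cornerShift hproj hP.commute α hX hβ
    rw [← hu, ← Units.val_neg, Ring.inverse_unit, Ring.inverse_unit, inv_neg, Units.val_neg,
      neg_neg]
  have hcompress : cornerResolvent ι P α X β = P * (cornerShift ι P α X β)⁻¹ʳ * star P := by
    rw [hproj.isSelfAdjoint.star_eq, (commute_ringInverse_right (commute_cornerShift
      hproj.isIdempotentElem hP.commute α X β)).eq, mul_assoc, hproj.isIdempotentElem.eq,
      cornerResolvent]
  refine ⟨c, hc, ?_⟩
  calc c • P = P * algebraMap ℝ 𝔐 c * star P := by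
        rw [hproj.isSelfAdjoint.star_eq, Algebra.algebraMap_eq_smul_one, mul_smul_comm,
          smul_mul_assoc, mul_one, hproj.isIdempotentElem.eq]
    _ ≤ _ := star_right_conjugate_le_conjugate (hneg ▸ h) P
    _ = _ := by rw [hcompress, coe_imaginaryPart_conj]

theorem cornerCauchy_mem_upperHalfPlane (hE : IsTracialCondExp ι τ E)
    (hP : IsIndependentProjection ι τ P α) {X : 𝔐} (hX : IsSelfAdjoint X) {β : 𝔅}
    (hβ : β ∈ upperHalfPlane 𝔅) : cornerCauchy ι E P α X β ∈ upperHalfPlane 𝔅 := by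
  obtain ⟨c, hc, h⟩ := exists_smul_le_imaginaryPart_cornerResolvent hP hX hβ
  refine ⟨c, hc, ?_⟩
  have hα : (α : ℂ) ≠ 0 := Complex.ofReal_ne_zero.2 hP.pos.ne'
  calc algebraMap ℝ 𝔅 c = α⁻¹ • E (c • P) := by
        rw [← Complex.coe_smul, ← Complex.coe_smul, map_smul, hE.condExp_proj hP, smul_comm,
          Complex.ofReal_inv, inv_smul_smul₀ hα, Algebra.algebraMap_eq_smul_one, Complex.coe_smul]
    _ ≤ α⁻¹ • E (ℑ (cornerResolvent ι P α X β) : 𝔐) :=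
        smul_le_smul_of_nonneg_left (hE.condExp_mono h) (inv_nonneg.2 hP.pos.le)
    _ = (ℑ (cornerCauchy ι E P α X β) : 𝔅) := by
        rw [cornerCauchy, ← Complex.ofReal_inv, Complex.coe_smul, map_smul,
          ← hE.coe_imaginaryPart_condExp]
        rfl

theorem subordination_mem_upperHalfPlane (hE : IsTracialCondExp ι τ E)
    (hP : IsIndependentProjection ι τ P α) {X : 𝔐} (hX : IsSelfAdjoint X) {β : 𝔅}
    (hβ : β ∈ upperHalfPlane 𝔅) : subordination ι E P α X β ∈ upperHalfPlane 𝔅 :=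
  pos_combination_mem_upperHalfPlane hβ
    (neg_inverse_mem_upperHalfPlane (cornerCauchy_mem_upperHalfPlane hE hP hX hβ)) hP.pos
    (sub_nonneg.2 hP.le_one)

theorem isUnit_sub_subordination (hE : IsTracialCondExp ι τ E)
    (hP : IsIndependentProjection ι τ P α) {X : 𝔐} (hX : IsSelfAdjoint X) {β : 𝔅}
    (hβ : β ∈ upperHalfPlane 𝔅) : IsUnit (X - ι (subordination ι E P α X β)) :=
  isUnit_sub_of_mem_upperHalfPlane hX
    (map_mem_upperHalfPlane ι (subordination_mem_upperHalfPlane hE hP hX hβ))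

theorem analyticAt_subordination (hE : IsTracialCondExp ι τ E)
    (hP : IsIndependentProjection ι τ P α) {X : 𝔐} (hX : IsSelfAdjoint X) {β : 𝔅}
    (hβ : β ∈ upperHalfPlane 𝔅) :
    AnalyticAt ℂ (fun x : 𝔐 × 𝔅 => subordination ι E P α x.1 x.2) (X, β) := by
  have hCauchy : AnalyticAt ℂ (fun x : 𝔐 × 𝔅 => cornerCauchy ι E P α x.1 x.2) (X, β) :=
    (((⟨E, hE.continuous_condExp⟩ : 𝔐 →L[ℂ] 𝔅).analyticAt _).comp
      (analyticAt_cornerResolvent hP.isStarProjection hP.commute α hX hβ)).const_smul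
        (c := (α : ℂ)⁻¹)
  exact (analyticAt_snd.const_smul (c := (α : ℂ))).add ((analyticAt_ringInverse_comp hCauchy
    (isUnit_of_mem_upperHalfPlane (cornerCauchy_mem_upperHalfPlane hE hP hX hβ))).neg.const_smul
      (c := ((1 - α : ℝ) : ℂ)))

theorem analyticOnNhd_subordination (hE : IsTracialCondExp ι τ E)
    (hP : IsIndependentProjection ι τ P α) {X : 𝔐} (hX : IsSelfAdjoint X) :
    AnalyticOnNhd ℂ (subordination ι E P α X) (upperHalfPlane 𝔅) := fun _ hβ =>
  (analyticAt_subordination hE hP hX hβ).comp_of_eq (analyticAt_const.prod analyticAt_id) rfl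

theorem analyticAt_subordinateResolvent (hE : IsTracialCondExp ι τ E)
    (hP : IsIndependentProjection ι τ P α) {X : 𝔐} (hX : IsSelfAdjoint X) {β : 𝔅}
    (hβ : β ∈ upperHalfPlane 𝔅) :
    AnalyticAt ℂ (fun x : 𝔐 × 𝔅 => subordinateResolvent ι E P α x.1 x.2) (X, β) := by
  refine analyticAt_ringInverse_comp ?_ (isUnit_sub_subordination hE hP hX hβ)
  exact analyticAt_fst.sub (((⟨ι.toLinearMap, map_continuous ι⟩ : 𝔅 →L[ℂ] 𝔐).analyticAt _).comp
    (analyticAt_subordination hE hP hX hβ))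

end Independent

/-! ### Inverting the subordination function -/

section Inversion

section Block

variable {K : Type*} [Ring K] {P x y Z : K}

theorem block_mul_rightInverse_mul_idempotent (hP : IsIdempotentElem P)
    (hZ : (P * x + (1 - P) * y) * Z = 1) : P * x * (Z * P) = P := by
  calc P * x * (Z * P) = P * (P * x + (1 - P) * y) * Z * P := by
        rw [mul_add, ← mul_assoc P P, hP.eq, ← mul_assoc P (1 - P), hP.mul_one_sub_self, zero_mul,
          add_zero, ← mul_assoc]
    _ = P := by rw [mul_assoc P, hZ, mul_one, hP.eq]

theorem mul_rightInverse_mul_idempotent_of_block (hP : IsIdempotentElem P) (hPy : Commute P y)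
    (hy : IsUnit y) (hZ : (P * x + (1 - P) * y) * Z = 1) : P * (Z * P) = Z * P := by
  have hzero : y * ((1 - P) * (Z * P)) = 0 := by
    calc y * ((1 - P) * (Z * P)) = (1 - P) * (P * x + (1 - P) * y) * Z * P := by
          rw [mul_add, ← mul_assoc (1 - P) P, hP.one_sub_mul_self, zero_mul, zero_add,
            ← mul_assoc (1 - P) (1 - P), hP.one_sub.eq, ((Commute.one_left y).sub_left hPy).eq]
          simp only [mul_assoc]
      _ = 0 := by rw [mul_assoc (1 - P), hZ, mul_one, hP.one_sub_mul_self]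
  rw [hy.mul_right_eq_zero, sub_mul, one_mul, sub_eq_zero] at hzero
  exact hzero.symm

end Block

variable {𝔐 𝔅 : Type*} [CStarAlgebra 𝔐] [CStarAlgebra 𝔅]

section Definitions

variable (ι : 𝔅 →⋆ₐ[ℂ] 𝔐) (E : 𝔐 →ₗ[ℂ] 𝔅) (α : ℝ)

/-- The compositional inverse `ω ↦ α⁻¹ (ω + (1 - α) h⁻¹)`, `h = E ((X - ω)⁻¹)`, of the subordination
function. -/
noncomputable def inverseSubordination (X : 𝔐) (ω : 𝔅) : 𝔅 :=
  (α : ℂ)⁻¹ • (ω + ((1 - α : ℝ) : ℂ) • (E (X - ι ω)⁻¹ʳ)⁻¹ʳ)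

/-- The resolvent `S = (X - ω)⁻¹`, normalized and centered: `(E S)⁻¹ S - 1`. -/
noncomputable def centeredResolvent (X : 𝔐) (ω : 𝔅) : 𝔐 :=
  ι (E (X - ι ω)⁻¹ʳ)⁻¹ʳ * (X - ι ω)⁻¹ʳ - 1

end Definitions

variable {ι : 𝔅 →⋆ₐ[ℂ] 𝔐} {E : 𝔐 →ₗ[ℂ] 𝔅} {P : 𝔐} {α : ℝ}

theorem centeredResolvent_mem {C : StarSubalgebra ℂ 𝔐} (hC : IsClosed (C : Set 𝔐))
    (hι : ∀ b, ι b ∈ C) {X : 𝔐} (hX : X ∈ C) (ω : 𝔅) : centeredResolvent ι E X ω ∈ C :=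
  sub_mem (mul_mem (hι _) (ringInverse_mem hC (sub_mem hX (hι ω)))) (one_mem C)

theorem condExp_centeredResolvent [PartialOrder 𝔐] {τ : 𝔐 →ₚ[ℂ] ℂ} (hE : IsTracialCondExp ι τ E)
    {X : 𝔐} {ω : 𝔅} (hh : IsUnit (E (X - ι ω)⁻¹ʳ)) : E (centeredResolvent ι E X ω) = 0 := by
  rw [centeredResolvent, map_sub, hE.condExp_mul_left, hE.condExp_one,
    Ring.inverse_mul_cancel _ hh, sub_self]

theorem smul_one_sub_mul_centeredResolvent_mul {X : 𝔐} {ω : 𝔅} (hα : α ≠ 0)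
    (hu : IsUnit (X - ι ω)) :
    ((α : ℂ) • 1 - (P - (α : ℂ) • 1) * centeredResolvent ι E X ω) * (X - ι ω) =
      P * (X - (α : ℂ) • ι (inverseSubordination ι E α X ω)) +
        (α : ℂ) • ((1 - P) * ι (E (X - ι ω)⁻¹ʳ)⁻¹ʳ) := by
  have hα' : (α : ℂ) ≠ 0 := Complex.ofReal_ne_zero.2 hα
  rw [inverseSubordination, centeredResolvent, map_smul, smul_inv_smul₀ hα', map_add, map_smul]
  set g := ι (E (X - ι ω)⁻¹ʳ)⁻¹ʳ
  have hcancel : (g * (X - ι ω)⁻¹ʳ - 1) * (X - ι ω) = g - (X - ι ω) := by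
    rw [sub_mul, Ring.inverse_mul_cancel_right _ _ hu, one_mul]
  rw [sub_mul, mul_assoc, hcancel]
  simp only [smul_mul_assoc, sub_mul, mul_sub, one_mul, mul_add, mul_smul_comm]
  push_cast
  module

theorem inv_smul_cornerResolvent_inverseSubordination {X : 𝔐} {ω : 𝔅}
    (hP : IsIdempotentElem P) (hcomm : ∀ b, Commute P (ι b)) (hα : α ≠ 0)
    (hu : IsUnit (X - ι ω)) (hh : IsUnit (E (X - ι ω)⁻¹ʳ))
    (hshift : IsUnit (cornerShift ι P α X (inverseSubordination ι E α X ω)))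
    (hw : IsUnit ((α : ℂ) • 1 - (P - (α : ℂ) • 1) * centeredResolvent ι E X ω)) :
    (α : ℂ)⁻¹ • cornerResolvent ι P α X (inverseSubordination ι E α X ω) =
      (X - ι ω)⁻¹ʳ * ((α : ℂ) • 1 - (P - (α : ℂ) • 1) * centeredResolvent ι E X ω)⁻¹ʳ * P := by
  have hα' : (α : ℂ) ≠ 0 := Complex.ofReal_ne_zero.2 hα
  have hfactor := smul_one_sub_mul_centeredResolvent_mul (E := E) (P := P) hα hu
  set β := inverseSubordination ι E α X ω
  set g := (E (X - ι ω)⁻¹ʳ)⁻¹ʳ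
  set W := (α : ℂ) • 1 - (P - (α : ℂ) • 1) * centeredResolvent ι E X ω
  set Z := (X - ι ω)⁻¹ʳ * W⁻¹ʳ
  have hZ : (P * (X - (α : ℂ) • ι β) + (1 - P) * ((α : ℂ) • ι g)) * Z = 1 := by
    rw [mul_smul_comm, ← hfactor, mul_assoc, Ring.mul_inverse_cancel_left _ _ hu,
      Ring.mul_inverse_cancel _ hw]
  have hcorner : P * (Z * P) = Z * P :=
    mul_rightInverse_mul_idempotent_of_block hP ((hcomm g).smul_right _)
      ((hh.ringInverse.map ι).smul (Units.mk0 (α : ℂ) hα')) hZ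
  have hsolve : cornerShift ι P α X β * (Z * P) = (α : ℂ)⁻¹ • P := by
    calc cornerShift ι P α X β * (Z * P) = cornerShift ι P α X β * P * (Z * P) := by
          rw [mul_assoc _ P, hcorner]
      _ = (α : ℂ)⁻¹ • (P * X * (Z * P)) - P * ι β * (Z * P) := by
          rw [cornerShift_mul hP, sub_mul, smul_mul_assoc, mul_assoc _ P, hcorner, (hcomm β).eq]
      _ = (α : ℂ)⁻¹ • (P * (X - (α : ℂ) • ι β) * (Z * P)) := by
          rw [mul_sub, sub_mul, smul_sub, mul_smul_comm, smul_mul_assoc, inv_smul_smul₀ hα']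
      _ = (α : ℂ)⁻¹ • P := by rw [block_mul_rightInverse_mul_idempotent hP hZ]
  rw [cornerResolvent, ← mul_smul_comm, ← hsolve, Ring.inverse_mul_cancel_left _ _ hshift]

end Inversion

/-! ### Free compressions -/

section Setting

variable {𝔐 𝔅 : Type*} [CStarAlgebra 𝔐] [PartialOrder 𝔐] [CStarAlgebra 𝔅]

/-- The closed subalgebra `C ⊇ ι 𝔅` is free from `P` over `𝔅`. Freeness enters only through a closed
subspace `𝒬` orthogonal to `C` that contains the alternating products of `P - α` and centered
elements of `C` that begin and end with `P - α`. -/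
structure IsCompressionSetting (ι : 𝔅 →⋆ₐ[ℂ] 𝔐) (τ : 𝔐 →ₚ[ℂ] ℂ) (E : 𝔐 →ₗ[ℂ] 𝔅) (P : 𝔐)
    (α : ℝ) (C : StarSubalgebra ℂ 𝔐) (𝒬 : Submodule ℂ 𝔐) : Prop
    extends IsTracialCondExp ι τ E, IsIndependentProjection ι τ P α where
  isClosed_subalgebra : IsClosed (C : Set 𝔐)
  map_mem : ∀ b, ι b ∈ C
  isClosed_submodule : IsClosed (𝒬 : Set 𝔐)
  proj_sub_mem : P - (α : ℂ) • 1 ∈ 𝒬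
  proj_sub_mul_mem : ∀ w ∈ 𝒬, ∀ v ∈ C, E v = 0 → (P - (α : ℂ) • 1) * v * w ∈ 𝒬
  trace_mul_eq_zero : ∀ w ∈ 𝒬, ∀ m ∈ C, τ (w * m) = 0

namespace IsCompressionSetting

variable {ι : 𝔅 →⋆ₐ[ℂ] 𝔐} {τ : 𝔐 →ₚ[ℂ] ℂ} {E : 𝔐 →ₗ[ℂ] 𝔅} {P : 𝔐} {α : ℝ}
  {C : StarSubalgebra ℂ 𝔐} {𝒬 : Submodule ℂ 𝔐}

theorem subordinateResolvent_mem (hS : IsCompressionSetting ι τ E P α C 𝒬) {X : 𝔐} (hXC : X ∈ C)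
    {β : 𝔅} : subordinateResolvent ι E P α X β ∈ C :=
  ringInverse_mem hS.isClosed_subalgebra (sub_mem hXC (hS.map_mem _))

theorem ringInverse_mul_mem (hS : IsCompressionSetting ι τ E P α C 𝒬) {v : 𝔐} (hv : v ∈ C)
    (hEv : E v = 0) (hsmall : ‖(α : ℂ)⁻¹ • ((P - (α : ℂ) • 1) * v)‖ < 1) :
    ((α : ℂ) • 1 - (P - (α : ℂ) • 1) * v)⁻¹ʳ * (P - (α : ℂ) • 1) ∈ 𝒬 := by
  have hα : (α : ℂ) ≠ 0 := Complex.ofReal_ne_zero.2 hS.pos.ne'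
  set Q := P - (α : ℂ) • 1
  set t := (α : ℂ)⁻¹ • (Q * v)
  have hpow (k : ℕ) : t ^ k * Q ∈ 𝒬 := by
    induction k with
    | zero => simpa only [pow_zero, one_mul] using hS.proj_sub_mem
    | succ k ih =>
      rw [pow_succ', mul_assoc, smul_mul_assoc]
      exact 𝒬.smul_mem _ (hS.proj_sub_mul_mem _ ih v hv hEv)
  have hinverse : ((α : ℂ) • 1 - Q * v)⁻¹ʳ = (α : ℂ)⁻¹ • ∑' k, t ^ k := by
    have hfactor : (α : ℂ) • 1 - Q * v = (α : ℂ) • (1 - t) := by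
      rw [smul_sub, smul_inv_smul₀ hα]
    refine ringInverse_eq_of_mul_eq_one ?_ ?_
    · rw [hfactor, smul_mul_smul_comm, mul_inv_cancel₀ hα, one_smul, mul_neg_geom_series t hsmall]
    · rw [hfactor, smul_mul_smul_comm, inv_mul_cancel₀ hα, one_smul, geom_series_mul_neg t hsmall]
  have hsum : HasSum (fun k => t ^ k * Q) ((∑' k, t ^ k) * Q) :=
    (summable_geometric_of_norm_lt_one hsmall).hasSum.mul_right Q
  rw [hinverse, smul_mul_assoc]
  exact 𝒬.smul_mem _ (hS.isClosed_submodule.mem_of_tendsto hsum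
    (.of_forall fun s => 𝒬.sum_mem fun k _ => hpow k))

variable [StarOrderedRing 𝔐] [PartialOrder 𝔅] [StarOrderedRing 𝔅]

theorem trace_cornerResolvent_inverseSubordination (hS : IsCompressionSetting ι τ E P α C 𝒬)
    {X : 𝔐} (hX : IsSelfAdjoint X) (hXC : X ∈ C) {ω : 𝔅} (hu : IsUnit (X - ι ω))
    (hh : IsUnit (E (X - ι ω)⁻¹ʳ)) (hβ : inverseSubordination ι E α X ω ∈ upperHalfPlane 𝔅)
    (hsmall : ‖(α : ℂ)⁻¹ • ((P - (α : ℂ) • 1) * centeredResolvent ι E X ω)‖ < 1) {m : 𝔐}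
    (hm : m ∈ C) :
    τ ((α : ℂ)⁻¹ • cornerResolvent ι P α X (inverseSubordination ι E α X ω) * m) =
      τ ((X - ι ω)⁻¹ʳ * m) := by
  have hα : (α : ℂ) ≠ 0 := Complex.ofReal_ne_zero.2 hS.pos.ne'
  have hv := centeredResolvent_mem (E := E) hS.isClosed_subalgebra hS.map_mem hXC ω
  have hw := isUnit_smul_one_sub hα hsmall
  have hWQ := hS.ringInverse_mul_mem hv (condExp_centeredResolvent hS.toIsTracialCondExp hh) hsmall
  rw [inv_smul_cornerResolvent_inverseSubordination hS.isStarProjection.isIdempotentElem hS.commute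
    hS.pos.ne' hu hh (isUnit_cornerShift hS.isStarProjection hS.commute α hX hβ) hw]
  set S := (X - ι ω)⁻¹ʳ
  set Q := P - (α : ℂ) • 1
  set v := centeredResolvent ι E X ω
  set W := ((α : ℂ) • 1 - Q * v)⁻¹ʳ
  have hSC : S ∈ C := ringInverse_mem hS.isClosed_subalgebra (sub_mem hXC (hS.map_mem ω))
  have hWP : W * P = 1 + W * Q * (1 + v) := by
    calc W * P = W * Q * (1 + v) + W * ((α : ℂ) • 1 - Q * v) := by
          rw [mul_assoc W, ← mul_add, mul_add Q, mul_one, add_add_sub_cancel, sub_add_cancel]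
      _ = 1 + W * Q * (1 + v) := by rw [Ring.inverse_mul_cancel _ hw, add_comm]
  calc τ (S * W * P * m) = τ (S * m) + τ (S * (W * Q * (1 + v)) * m) := by
        rw [mul_assoc S, hWP, mul_add, mul_one, add_mul, map_add]
    _ = τ (S * m) + τ (W * Q * ((1 + v) * m * S)) := by
        rw [mul_assoc S (W * Q * _), hS.trace_comm S (_ * m), mul_assoc (W * Q), mul_assoc (W * Q)]
    _ = τ (S * m) := by
        rw [hS.trace_mul_eq_zero _ hWQ _ (mul_mem (mul_mem (add_mem (one_mem C) hv) hm) hSC),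
          add_zero]

theorem subordination_inverseSubordination (hS : IsCompressionSetting ι τ E P α C 𝒬)
    {X : 𝔐} (hX : IsSelfAdjoint X) (hXC : X ∈ C) {ω : 𝔅} (hu : IsUnit (X - ι ω))
    (hh : IsUnit (E (X - ι ω)⁻¹ʳ)) (hβ : inverseSubordination ι E α X ω ∈ upperHalfPlane 𝔅)
    (hsmall : ‖(α : ℂ)⁻¹ • ((P - (α : ℂ) • 1) * centeredResolvent ι E X ω)‖ < 1) :
    subordination ι E P α X (inverseSubordination ι E α X ω) = ω := by
  have hα : (α : ℂ) ≠ 0 := Complex.ofReal_ne_zero.2 hS.pos.ne'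
  have hCauchy : cornerCauchy ι E P α X (inverseSubordination ι E α X ω) = E (X - ι ω)⁻¹ʳ := by
    rw [cornerCauchy, ← map_smul]
    refine hS.condExp_eq fun b => ?_
    rw [hS.trace_condExp_mul]
    exact hS.trace_cornerResolvent_inverseSubordination hX hXC hu hh hβ hsmall (hS.map_mem b)
  rw [subordination, hCauchy, inverseSubordination, smul_inv_smul₀ hα, smul_neg,
    add_neg_cancel_right]

end IsCompressionSetting
end Setting

/-! ### Small perturbations and analytic continuation -/

section Continuation

open Filter Topology

variable {𝔐 𝔅 : Type*} [CStarAlgebra 𝔐] [CStarAlgebra 𝔅] {ι : 𝔅 →⋆ₐ[ℂ] 𝔐}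

theorem isUnit_zero_sub_map {ω : 𝔅} (hω : IsUnit ω) : IsUnit ((0 : 𝔐) - ι ω) := by
  rw [zero_sub, IsUnit.neg_iff]
  exact hω.map ι

theorem ringInverse_zero_sub_map {ω : 𝔅} (hω : IsUnit ω) :
    ((0 : 𝔐) - ι ω)⁻¹ʳ = ι (-ω⁻¹ʳ) := by
  rw [zero_sub, ← map_neg]
  exact ringInverse_eq_of_mul_eq_one
    (by rw [← map_mul, neg_mul_neg, Ring.mul_inverse_cancel _ hω, map_one])
    (by rw [← map_mul, neg_mul_neg, Ring.inverse_mul_cancel _ hω, map_one])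

variable [PartialOrder 𝔐] {τ : 𝔐 →ₚ[ℂ] ℂ} {E : 𝔐 →ₗ[ℂ] 𝔅} {P : 𝔐} {α : ℝ}

theorem ringInverse_condExp_resolvent_zero (hE : IsTracialCondExp ι τ E) {ω : 𝔅}
    (hω : IsUnit ω) : (E ((0 : 𝔐) - ι ω)⁻¹ʳ)⁻¹ʳ = -ω := by
  rw [ringInverse_zero_sub_map hω, hE.condExp_map]
  exact ringInverse_eq_of_mul_eq_one (by rw [neg_mul_neg, Ring.inverse_mul_cancel _ hω])
    (by rw [neg_mul_neg, Ring.mul_inverse_cancel _ hω])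

theorem isUnit_condExp_resolvent_zero (hE : IsTracialCondExp ι τ E) {ω : 𝔅} (hω : IsUnit ω) :
    IsUnit (E ((0 : 𝔐) - ι ω)⁻¹ʳ) := by
  rw [ringInverse_zero_sub_map hω, hE.condExp_map, IsUnit.neg_iff]
  exact hω.ringInverse

theorem inverseSubordination_zero (hE : IsTracialCondExp ι τ E) (hα : α ≠ 0) {ω : 𝔅}
    (hω : IsUnit ω) : inverseSubordination ι E α 0 ω = ω := by
  have hα' : (α : ℂ) ≠ 0 := Complex.ofReal_ne_zero.2 hα
  rw [inverseSubordination, ringInverse_condExp_resolvent_zero hE hω, inv_smul_eq_iff₀ hα']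
  push_cast
  module

theorem centeredResolvent_zero (hE : IsTracialCondExp ι τ E) {ω : 𝔅} (hω : IsUnit ω) :
    centeredResolvent ι E 0 ω = 0 := by
  rw [centeredResolvent, ringInverse_condExp_resolvent_zero hE hω, ringInverse_zero_sub_map hω,
    ← map_mul, neg_mul_neg, Ring.mul_inverse_cancel _ hω, map_one, sub_self]

variable [StarOrderedRing 𝔐] [PartialOrder 𝔅] [StarOrderedRing 𝔅]

theorem analyticAt_condExp_resolvent (hE : IsTracialCondExp ι τ E) {X : 𝔐} {ω : 𝔅}
    (hu : IsUnit (X - ι ω)) :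
    AnalyticAt ℂ (fun x : 𝔐 × 𝔅 => E (x.1 - ι x.2)⁻¹ʳ) (X, ω) := by
  have hι : AnalyticAt ℂ (fun x : 𝔐 × 𝔅 => ι x.2) (X, ω) :=
    ((⟨ι.toLinearMap, map_continuous ι⟩ : 𝔅 →L[ℂ] 𝔐).analyticAt ω).comp analyticAt_snd
  exact ((⟨E, hE.continuous_condExp⟩ : 𝔐 →L[ℂ] 𝔅).analyticAt _).comp
    (analyticAt_ringInverse_comp (analyticAt_fst.sub hι) hu)

theorem analyticAt_inverseSubordination (hE : IsTracialCondExp ι τ E) {X : 𝔐} {ω : 𝔅}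
    (hu : IsUnit (X - ι ω)) (hh : IsUnit (E (X - ι ω)⁻¹ʳ)) :
    AnalyticAt ℂ (fun x : 𝔐 × 𝔅 => inverseSubordination ι E α x.1 x.2) (X, ω) :=
  (analyticAt_snd.add ((analyticAt_ringInverse_comp (analyticAt_condExp_resolvent hE hu)
    hh).const_smul (c := ((1 - α : ℝ) : ℂ)))).const_smul (c := (α : ℂ)⁻¹)

theorem continuousAt_centeredResolvent (hE : IsTracialCondExp ι τ E) {X : 𝔐} {ω : 𝔅}
    (hu : IsUnit (X - ι ω)) (hh : IsUnit (E (X - ι ω)⁻¹ʳ)) :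
    ContinuousAt (fun x : 𝔐 × 𝔅 => centeredResolvent ι E x.1 x.2) (X, ω) := by
  have hι : AnalyticAt ℂ (fun x : 𝔐 × 𝔅 => ι x.2) (X, ω) :=
    ((⟨ι.toLinearMap, map_continuous ι⟩ : 𝔅 →L[ℂ] 𝔐).analyticAt ω).comp analyticAt_snd
  have hCauchy := analyticAt_ringInverse_comp (analyticAt_condExp_resolvent hE hu) hh
  exact (((map_continuous ι).continuousAt.comp hCauchy.continuousAt).mul
    (analyticAt_ringInverse_comp (analyticAt_fst.sub hι) hu).continuousAt).sub continuousAt_const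

theorem eventually_norm_centeredResolvent_lt_one (hE : IsTracialCondExp ι τ E) (c : ℂ) (a : 𝔐)
    {β : 𝔅} (hβ : IsUnit β) :
    ∀ᶠ x : 𝔐 × 𝔅 in 𝓝 (0, β), ‖c • (a * centeredResolvent ι E x.1 x.2)‖ < 1 := by
  have hlim : Tendsto (fun x : 𝔐 × 𝔅 => ‖c • (a * centeredResolvent ι E x.1 x.2)‖) (𝓝 (0, β))
      (𝓝 ‖c • (a * centeredResolvent ι E 0 β)‖) :=
    (((continuousAt_centeredResolvent hE (isUnit_zero_sub_map hβ)
      (isUnit_condExp_resolvent_zero hE hβ)).const_mul a).const_smul c).norm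
  rw [centeredResolvent_zero hE hβ, mul_zero, smul_zero, norm_zero] at hlim
  exact hlim.eventually_lt_const one_pos

theorem exists_tendsto_inverseSubordination_eq (hE : IsTracialCondExp ι τ E) (hα : α ≠ 0) {β : 𝔅}
    (hβ : IsUnit β) : ∃ ψ : 𝔐 → 𝔅, Tendsto ψ (𝓝 0) (𝓝 β) ∧
      ∀ᶠ x in 𝓝 0, inverseSubordination ι E α x (ψ x) = β := by
  have hstrict := (analyticAt_inverseSubordination (α := α) hE (isUnit_zero_sub_map hβ)
    (isUnit_condExp_resolvent_zero hE hβ)).hasStrictFDerivAt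
  have hpartial : fderiv ℂ (fun x : 𝔐 × 𝔅 => inverseSubordination ι E α x.1 x.2) (0, β) ∘L
      .inr ℂ 𝔐 𝔅 = .id ℂ 𝔅 := by
    refine (hstrict.hasFDerivAt.comp β (hasFDerivAt_prodMk_right 0 β)).unique
      ((hasFDerivAt_id β).congr_of_eventuallyEq ?_)
    filter_upwards [Units.isOpen.mem_nhds hβ] with ω hω
    exact inverseSubordination_zero hE hα hω
  have hinvertible : (fderiv ℂ (fun x : 𝔐 × 𝔅 => inverseSubordination ι E α x.1 x.2) (0, β) ∘L
      .inr ℂ 𝔐 𝔅).IsInvertible := hpartial ▸ ⟨.refl ℂ 𝔅, rfl⟩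
  refine ⟨_, hstrict.tendsto_implicitFunctionOfProdDomain hinvertible, ?_⟩
  filter_upwards [hstrict.eventually_apply_implicitFunctionOfProdDomain hinvertible] with x hx
  exact hx.trans (inverseSubordination_zero hE hα hβ)

namespace IsCompressionSetting

variable {C : StarSubalgebra ℂ 𝔐} {𝒬 : Submodule ℂ 𝔐}

theorem eventually_trace_cornerResolvent (hS : IsCompressionSetting ι τ E P α C 𝒬) {β : 𝔅}
    (hβ : β ∈ upperHalfPlane 𝔅) : ∀ᶠ X in 𝓝 (0 : 𝔐), IsSelfAdjoint X → X ∈ C → ∀ m ∈ C,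
      τ ((α : ℂ)⁻¹ • cornerResolvent ι P α X β * m) = τ (subordinateResolvent ι E P α X β * m) := by
  have hE := hS.toIsTracialCondExp
  have hβu := isUnit_of_mem_upperHalfPlane hβ
  have hu := isUnit_zero_sub_map (𝔐 := 𝔐) (ι := ι) hβu
  have hh := isUnit_condExp_resolvent_zero hE hβu
  obtain ⟨ψ, hψ, hψβ⟩ := exists_tendsto_inverseSubordination_eq (α := α) hE hS.pos.ne' hβu
  have hpair : Tendsto (fun X => (X, ψ X)) (𝓝 0) (𝓝 ((0 : 𝔐), β)) := tendsto_id.prodMk_nhds hψ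
  have hresolvent : ∀ᶠ x : 𝔐 × 𝔅 in 𝓝 (0, β), IsUnit (x.1 - ι x.2) :=
    (continuous_fst.sub ((map_continuous ι).comp continuous_snd)).continuousAt.eventually
      (Units.isOpen.mem_nhds hu)
  have hCauchy := (analyticAt_condExp_resolvent hE hu).continuousAt.eventually_mem
    (Units.isOpen.mem_nhds hh)
  have hsmall := eventually_norm_centeredResolvent_lt_one hE (α : ℂ)⁻¹ (P - (α : ℂ) • 1) hβu
  filter_upwards [hψβ, hpair.eventually hresolvent, hpair.eventually hCauchy,
    hpair.eventually hsmall] with X hXβ hu hh hsmall hX hXC m hm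
  rw [← hXβ] at hβ
  rw [subordinateResolvent, ← hXβ,
    hS.subordination_inverseSubordination hX hXC hu hh hβ hsmall]
  exact hS.trace_cornerResolvent_inverseSubordination hX hXC hu hh hβ hsmall hm

theorem trace_cornerResolvent (hS : IsCompressionSetting ι τ E P α C 𝒬) {X : 𝔐}
    (hX : IsSelfAdjoint X) (hXC : X ∈ C) {β : 𝔅} (hβ : β ∈ upperHalfPlane 𝔅) {m : 𝔐}
    (hm : m ∈ C) :
    τ ((α : ℂ)⁻¹ • cornerResolvent ι P α X β * m) = τ (subordinateResolvent ι E P α X β * m) := by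
  let τ' : 𝔐 →L[ℂ] ℂ := ⟨τ.toLinearMap, map_continuous τ⟩
  set f : 𝔐 × 𝔅 → ℂ := fun x => τ ((α : ℂ)⁻¹ • cornerResolvent ι P α x.1 x.2 * m) -
    τ (subordinateResolvent ι E P α x.1 x.2 * m) with hf
  have hanalytic : AnalyticOnNhd ℝ (fun z : ℝ => f (z • X, β)) Set.univ := fun z _ => by
    have hzX : IsSelfAdjoint (z • X) := (IsSelfAdjoint.all z).smul hX
    have hfz : AnalyticAt ℂ f (z • X, β) :=
      ((τ'.analyticAt _).comp (((analyticAt_cornerResolvent hS.isStarProjection hS.commute α hzX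
        hβ).const_smul (c := (α : ℂ)⁻¹)).mul analyticAt_const)).sub
      ((τ'.analyticAt _).comp ((analyticAt_subordinateResolvent hS.toIsTracialCondExp
        hS.toIsIndependentProjection hzX hβ).mul analyticAt_const))
    exact (hfz.restrictScalars (𝕜 := ℝ)).comp_of_eq
      ((((ContinuousLinearMap.id ℝ ℝ).smulRight X).analyticAt z).prod analyticAt_const) rfl
  have hsmall : ∀ᶠ z : ℝ in 𝓝 0, f (z • X, β) = 0 := by
    have hzero : Tendsto (fun z : ℝ => z • X) (𝓝 0) (𝓝 0) :=
      Continuous.tendsto' (by fun_prop) _ _ (zero_smul ℝ X)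
    filter_upwards [hzero.eventually (hS.eventually_trace_cornerResolvent hβ)] with z hz
    exact sub_eq_zero.2 (hz ((IsSelfAdjoint.all z).smul hX) (C.smul_mem hXC (z : ℂ)) m hm)
  have hall := hanalytic.eqOn_zero_of_preconnected_of_eventuallyEq_zero isPreconnected_univ
    (Set.mem_univ 0) hsmall (Set.mem_univ 1)
  simp only [hf, one_smul, Pi.zero_apply] at hall
  exact sub_eq_zero.1 hall

end IsCompressionSetting
end Continuation

/-! ### Countable multiples of the identity representation -/

section Ampliation

open Filter Topology

variable {H : Type*} [NormedAddCommGroup H] [InnerProductSpace ℂ H]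

theorem memℓp_apply (a : H →L[ℂ] H) (f : lp (fun _ : ℕ => H) 2) : Memℓp (fun k => a (f k)) 2 :=
  ((lp.memℓp f).const_smul (‖a‖ : ℂ)).mono' fun k => by
    simpa [norm_smul] using a.le_opNorm (f k)

/-- The operator `a ⊗ 1` on `ℓ²(ℕ, H)`, which applies `a` to every coordinate. -/
noncomputable def diagMap (a : H →L[ℂ] H) : lp (fun _ : ℕ => H) 2 →L[ℂ] lp (fun _ : ℕ => H) 2 :=
  LinearMap.mkContinuous
    { toFun f := ⟨fun k => a (f k), memℓp_apply a f⟩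
      map_add' f g := by ext k; exact map_add a (f k) (g k)
      map_smul' c f := by ext k; exact map_smul a c (f k) } ‖a‖ fun f => by
    refine (lp.norm_mono (y := (‖a‖ : ℂ) • f) two_ne_zero fun k => ?_).trans_eq
      (by rw [norm_smul, Complex.norm_real, norm_norm])
    rw [lp.coeFn_smul, Pi.smul_apply, norm_smul, Complex.norm_real, norm_norm]
    exact a.le_opNorm (f k)

@[simp]
theorem diagMap_apply (a : H →L[ℂ] H) (f : lp (fun _ : ℕ => H) 2) (k : ℕ) :
    diagMap a f k = a (f k) := rfl

theorem diagMap_single (a : H →L[ℂ] H) (j : ℕ) (x : H) :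
    diagMap a (lp.single 2 j x) = lp.single 2 j (a x) := by
  ext k
  rcases eq_or_ne k j with rfl | h
  · simp
  · simp [h]

/-- The orbit map `a ↦ (a ⊗ 1) Ξ` of a vector `Ξ ∈ ℓ²(ℕ, H)`. -/
noncomputable def orbit (Ξ : lp (fun _ : ℕ => H) 2) :
    (H →L[ℂ] H) →ₗ[ℂ] lp (fun _ : ℕ => H) 2 where
  toFun a := diagMap a Ξ
  map_add' a b := by ext k; simp
  map_smul' c a := by ext k; simp

@[simp]
theorem orbit_apply (Ξ : lp (fun _ : ℕ => H) 2) (a : H →L[ℂ] H) (k : ℕ) :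
    orbit Ξ a k = a (Ξ k) := rfl

theorem orbit_one (Ξ : lp (fun _ : ℕ => H) 2) : orbit Ξ 1 = Ξ := by ext k; simp

theorem diagMap_orbit (Ξ : lp (fun _ : ℕ => H) 2) (a b : H →L[ℂ] H) :
    diagMap a (orbit Ξ b) = orbit Ξ (a * b) := by ext k; simp

theorem commute_diagMap_of_mem_centralizer_centralizer {S : Set (H →L[ℂ] H)}
    {T : lp (fun _ : ℕ => H) 2 →L[ℂ] lp (fun _ : ℕ => H) 2} (hT : ∀ d ∈ S, Commute T (diagMap d))
    {a : H →L[ℂ] H} (ha : a ∈ S.centralizer.centralizer) : Commute T (diagMap a) := by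
  let entry (i j : ℕ) : H →L[ℂ] H := (lp.evalCLM ℂ (fun _ : ℕ => H) 2 i).comp
    (T.comp (lp.singleContinuousLinearMap ℂ (fun _ : ℕ => H) 2 j))
  have entry_apply (i j : ℕ) (x : H) : entry i j x = T (lp.single 2 j x) i := rfl
  have entry_mem (i j : ℕ) : entry i j ∈ S.centralizer := by
    intro d hd
    ext x
    change d (entry i j x) = entry i j (d x)
    rw [entry_apply, entry_apply, ← diagMap_single, ← diagMap_apply]
    exact congrArg (fun R => R (lp.single 2 j x) i) (hT d hd).symm
  refine lp.ext_continuousLinearMap (by simp) fun j => ?_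
  ext x i
  change T (diagMap a (lp.single 2 j x)) i = diagMap a (T (lp.single 2 j x)) i
  rw [diagMap_single, diagMap_apply, ← entry_apply, ← entry_apply]
  exact congrArg (fun R : H →L[ℂ] H => R x) (ha _ (entry_mem i j))

variable [CompleteSpace H]

theorem adjoint_diagMap (a : H →L[ℂ] H) :
    ContinuousLinearMap.adjoint (diagMap a) = diagMap (ContinuousLinearMap.adjoint a) := by
  refine ((ContinuousLinearMap.eq_adjoint_iff _ _).2 fun f g => ?_).symm
  simp only [lp.inner_eq_tsum, diagMap_apply, ContinuousLinearMap.adjoint_inner_left]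

theorem commute_starProjection {V : Submodule ℂ H} [V.HasOrthogonalProjection] {T : H →L[ℂ] H}
    (hT : V ∈ Module.End.invtSubmodule T.toLinearMap)
    (hT' : V ∈ Module.End.invtSubmodule (ContinuousLinearMap.adjoint T).toLinearMap) :
    Commute V.starProjection T := by
  rw [ContinuousLinearMap.IsIdempotentElem.commute_iff
    isStarProjection_starProjection.isIdempotentElem, Submodule.range_starProjection,
    Submodule.ker_starProjection]
  exact ⟨hT, ContinuousLinearMap.orthogonal_mem_invtSubmodule hT'⟩

theorem orbit_mem_closure (A : StarSubalgebra ℂ (H →L[ℂ] H)) (Ξ : lp (fun _ : ℕ => H) 2)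
    {a : H →L[ℂ] H} (ha : a ∈ Set.centralizer (Set.centralizer (A : Set (H →L[ℂ] H)))) :
    orbit Ξ a ∈ closure (orbit Ξ '' A) := by
  set V := (A.toSubalgebra.toSubmodule.map (orbit Ξ)).topologicalClosure
  have : CompleteSpace V := (Submodule.isClosed_topologicalClosure _).completeSpace_coe
  have invariant (d : H →L[ℂ] H) (hd : d ∈ A) :
      V ∈ Module.End.invtSubmodule (diagMap d).toLinearMap := by
    refine fun f hf => map_mem_closure (diagMap d).continuous hf ?_
    rintro _ ⟨b, hb, rfl⟩
    exact ⟨d * b, A.mul_mem hd hb, (diagMap_orbit Ξ d b).symm⟩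
  have hcomm : Commute V.starProjection (diagMap a) :=
    commute_diagMap_of_mem_centralizer_centralizer (fun d hd => commute_starProjection
      (invariant d hd) (by rw [adjoint_diagMap]; exact invariant _ (star_mem hd))) ha
  have hΞ : Ξ ∈ V := Submodule.le_topologicalClosure _ ⟨1, A.one_mem, orbit_one Ξ⟩
  suffices diagMap a Ξ = V.starProjection (diagMap a Ξ) by
    change diagMap a Ξ ∈ V
    rw [this]
    exact V.starProjection_apply_mem _
  conv_lhs => rw [← (Submodule.starProjection_eq_self_iff).2 hΞ]
  exact congrArg (fun T => T Ξ) hcomm.symm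

end Ampliation

/-! ### Bounded strongly convergent sequences -/

section StrongLimit

open Filter Topology

variable {H : Type*} [NormedAddCommGroup H] [InnerProductSpace ℂ H]

theorem cauchySeq_apply_of_mem_closure {b : ℕ → H →L[ℂ] H} {r : ℝ} (hb : ∀ k, ‖b k‖ ≤ r)
    {S : Set H} (hS : ∀ x ∈ S, CauchySeq fun k => b k x) {x : H} (hx : x ∈ closure S) :
    CauchySeq fun k => b k x := by
  have hr : 0 ≤ r := (norm_nonneg _).trans (hb 0)
  rw [Metric.cauchySeq_iff']
  intro ε hε
  obtain ⟨y, hy, hxy⟩ := Metric.mem_closure_iff.1 hx (ε / (3 * (r + 1))) (by positivity)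
  obtain ⟨N, hN⟩ := Metric.cauchySeq_iff'.1 (hS y hy) (ε / 3) (by positivity)
  have hdist (k : ℕ) : dist (b k x) (b k y) < ε / 3 := by
    rw [dist_eq_norm] at hxy ⊢
    calc ‖b k x - b k y‖ = ‖b k (x - y)‖ := by rw [map_sub]
      _ ≤ r * ‖x - y‖ := (b k).le_of_opNorm_le (hb k) _
      _ ≤ (r + 1) * ‖x - y‖ := by gcongr; linarith
      _ < (r + 1) * (ε / (3 * (r + 1))) := by gcongr
      _ = ε / 3 := by field_simp
  refine ⟨N, fun n hn => ?_⟩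
  have htriangle := dist_triangle4 (b n x) (b n y) (b N y) (b N x)
  linarith [hdist n, hdist N, hN n hn, dist_comm (b N x) (b N y)]

theorem exists_tendsto_apply [CompleteSpace H] {b : ℕ → H →L[ℂ] H} {r : ℝ} (hb : ∀ k, ‖b k‖ ≤ r)
    {S : Set H} (hS : Dense (Submodule.span ℂ S : Set H))
    (hbS : ∀ x ∈ S, CauchySeq fun k => b k x) :
    ∃ a : H →L[ℂ] H, ‖a‖ ≤ r ∧ ∀ x, Tendsto (fun k => b k x) atTop (𝓝 (a x)) := by
  have hspan : ∀ x ∈ Submodule.span ℂ S, CauchySeq fun k => b k x := by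
    intro x hx
    induction hx using Submodule.span_induction with
    | mem x hx => exact hbS x hx
    | zero => simpa using cauchySeq_const (0 : H)
    | add x y _ _ hx hy => simpa [Pi.add_def] using hx.add hy
    | smul c x _ hx =>
      simp only [map_smul]
      exact (uniformContinuous_const_smul c).comp_cauchySeq hx
  choose f hf using fun x =>
    cauchySeq_tendsto_of_complete (cauchySeq_apply_of_mem_closure hb hspan (hS x))
  refine ⟨continuousLinearMapOfTendsto b (tendsto_pi_nhds.2 hf), ?_, hf⟩
  refine ContinuousLinearMap.opNorm_le_bound _ ((norm_nonneg _).trans (hb 0)) fun x => ?_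
  exact le_of_tendsto (hf x).norm (Eventually.of_forall fun k => (b k).le_of_opNorm_le (hb k) x)

variable [CompleteSpace H]

theorem dense_span_commutant (M : VonNeumannAlgebra H) {ι : Type*} {ξ : ι → H}
    (hsep : ∀ a ∈ M, (∀ k, a (ξ k) = 0) → a = 0) :
    Dense (Submodule.span ℂ {x | ∃ c ∈ M.commutant, ∃ k, x = c (ξ k)} : Set H) := by
  set V := (Submodule.span ℂ {x | ∃ c ∈ M.commutant, ∃ k, x = c (ξ k)}).topologicalClosure
    with hV
  have : CompleteSpace V := (Submodule.isClosed_topologicalClosure _).completeSpace_coe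
  have invariant (d : H →L[ℂ] H) (hd : d ∈ M.commutant) :
      V ∈ Module.End.invtSubmodule d.toLinearMap := by
    refine fun f hf => map_mem_closure d.continuous hf fun x hx => ?_
    refine (Submodule.map_span_le d.toLinearMap _ _).2 ?_ (Submodule.mem_map_of_mem hx)
    rintro _ ⟨c, hc, k, rfl⟩
    exact Submodule.subset_span ⟨d * c, mul_mem hd hc, k, rfl⟩
  have hmem : V.starProjection ∈ M := by
    rw [VonNeumannAlgebra.IsStarProjection.mem_iff isStarProjection_starProjection,
      Submodule.range_starProjection]
    exact invariant
  have hone : (1 : H →L[ℂ] H) - V.starProjection = 0 := by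
    refine hsep _ (sub_mem (one_mem M) hmem) fun k => ?_
    have : ξ k ∈ V := Submodule.le_topologicalClosure _
      (Submodule.subset_span ⟨1, one_mem _, k, by simp⟩)
    simp [(Submodule.starProjection_eq_self_iff).2 this]
  rw [Submodule.dense_iff_topologicalClosure_eq_top, ← hV, ← Submodule.range_starProjection V,
    ← sub_eq_zero.1 hone]
  exact LinearMap.range_id

theorem mem_of_tendsto_apply {B : VonNeumannAlgebra H} {b : ℕ → H →L[ℂ] H} (hb : ∀ n, b n ∈ B)
    {a : H →L[ℂ] H} (ha : ∀ x, Tendsto (fun n => b n x) atTop (𝓝 (a x))) : a ∈ B := by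
  rw [← B.commutant_commutant, VonNeumannAlgebra.mem_commutant_iff]
  intro c hc
  ext y
  refine tendsto_nhds_unique ((c.continuous.tendsto _).comp (ha y)) ((ha (c y)).congr fun n => ?_)
  exact congrArg (fun T : H →L[ℂ] H => T y) (VonNeumannAlgebra.mem_commutant_iff.1 hc (b n) (hb n))

theorem isClosed_orbit_ball {B : VonNeumannAlgebra H} {Ξ : lp (fun _ : ℕ => H) 2}
    (hsep : ∀ a ∈ B, (∀ k, a (Ξ k) = 0) → a = 0) (r : ℝ) :
    IsClosed (orbit Ξ '' {b | b ∈ B ∧ ‖b‖ ≤ r}) := by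
  rw [← isSeqClosed_iff_isClosed]
  intro x η hx hη
  choose b hb hbx using hx
  obtain rfl : (fun n => orbit Ξ (b n)) = x := funext hbx
  have hcoord (k : ℕ) : Tendsto (fun n => b n (Ξ k)) atTop (𝓝 (η k)) :=
    ((lp.evalCLM ℂ (fun _ : ℕ => H) 2 k).continuous.tendsto η).comp hη
  have hcauchy : ∀ x ∈ {x | ∃ c ∈ B.commutant, ∃ k, x = c (Ξ k)},
      CauchySeq fun n => b n x := by
    rintro _ ⟨c, hc, k, rfl⟩
    refine (((c.continuous.tendsto _).comp (hcoord k)).congr fun n => ?_).cauchySeq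
    exact (congrArg (fun T : H →L[ℂ] H => T (Ξ k))
      (VonNeumannAlgebra.mem_commutant_iff.1 hc (b n) (hb n).1)).symm
  obtain ⟨a, har, ha⟩ :=
    exists_tendsto_apply (fun n => (hb n).2) (dense_span_commutant B hsep) hcauchy
  refine ⟨a, ⟨mem_of_tendsto_apply (fun n => (hb n).1) ha, har⟩, ?_⟩
  ext k
  exact tendsto_nhds_unique (ha (Ξ k)) (hcoord k)

end StrongLimit

/-! ### Existence of the conditional expectation -/

section Truncation

variable {𝔐 𝔅 : Type*} [CStarAlgebra 𝔐] [PartialOrder 𝔐] [CStarAlgebra 𝔅]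
  {ι : 𝔅 →⋆ₐ[ℂ] 𝔐} {τ : 𝔐 →ₚ[ℂ] ℂ}

theorem trace_star_mul_self_sub (hτ : ∀ a b, τ (a * b) = τ (b * a)) {a : 𝔐}
    (ha : IsSelfAdjoint a) (b : 𝔅) :
    τ (star (a - ι b) * (a - ι b)) = τ (star (a - ι (ℜ b : 𝔅)) * (a - ι (ℜ b : 𝔅))) +
      τ (ι (star (ℑ b : 𝔅) * (ℑ b : 𝔅))) := by
  have hu : star (a - ι (ℜ b : 𝔅)) = a - ι (ℜ b : 𝔅) := (ha.sub ((ℜ b).2.map ι)).star_eq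
  have hv : star (ι (ℑ b : 𝔅)) = ι (ℑ b : 𝔅) := ((ℑ b).2.map ι).star_eq
  have hb : a - ι b = (a - ι (ℜ b : 𝔅)) - Complex.I • ι (ℑ b : 𝔅) := by
    conv_lhs => rw [← realPart_add_I_smul_imaginaryPart b]
    rw [map_add, map_smul, sub_sub]
  rw [hb, map_mul ι, map_star, hv, star_sub, star_smul, hu, hv]
  generalize a - ι (ℜ b : 𝔅) = u
  generalize ι (ℑ b : 𝔅) = v
  simp only [sub_mul, mul_sub, smul_mul_assoc, mul_smul_comm, map_sub, map_smul, hτ v u,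
    smul_eq_mul, Complex.star_def, Complex.conj_I]
  linear_combination -τ (v * v) * Complex.I_sq

variable [StarOrderedRing 𝔐] [PartialOrder 𝔅] [StarOrderedRing 𝔅]

theorem trace_star_mul_self_sub_posPart_le (hτ : ∀ a b, τ (a * b) = τ (b * a)) {a : 𝔐} (ha : 0 ≤ a)
    {b : 𝔅} (hb : IsSelfAdjoint b) :
    τ (star (a - ι b⁺) * (a - ι b⁺)) ≤ τ (star (a - ι b) * (a - ι b)) := by
  have hpos : star (ι b⁺) = ι b⁺ := (map_nonneg ι (CFC.posPart_nonneg b)).isSelfAdjoint.star_eq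
  have hneg : 0 ≤ ι b⁻ := map_nonneg ι (CFC.negPart_nonneg b)
  have hmul : ι b⁺ * ι b⁻ = 0 := by rw [← map_mul, CFC.posPart_mul_negPart, map_zero]
  have hmul' : ι b⁻ * ι b⁺ = 0 := by rw [← map_mul, CFC.negPart_mul_posPart, map_zero]
  have hexpand : τ (star (a - ι b) * (a - ι b)) = τ (star (a - ι b⁺) * (a - ι b⁺)) +
      2 * τ (a * ι b⁻) + τ (star (ι b⁻) * ι b⁻) := by
    conv_lhs => rw [← CFC.posPart_sub_negPart b, map_sub]
    simp only [star_sub, ha.isSelfAdjoint.star_eq, hpos, hneg.isSelfAdjoint.star_eq, sub_mul,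
      mul_sub, map_sub, hmul, hmul', map_zero, hτ (ι b⁻) a]
    ring
  rw [hexpand, add_assoc]
  have hcross : 0 ≤ τ (a * ι b⁻) := trace_mul_nonneg hτ ha hneg
  have hsquare : 0 ≤ τ (star (ι b⁻) * ι b⁻) := map_nonneg τ (star_mul_self_nonneg _)
  exact le_add_of_nonneg_right (by positivity)

theorem posPart_le_algebraMap {b : 𝔅} {r : ℝ} (hr : 0 ≤ r) (hb : b ≤ algebraMap ℝ 𝔅 r) :
    b⁺ ≤ algebraMap ℝ 𝔅 r := by
  have hsa : IsSelfAdjoint b := .of_le hb (.algebraMap _ (.all r))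
  rw [CFC.posPart_def, cfcₙ_eq_cfc]
  exact cfc_le_algebraMap _ r b fun x hx =>
    max_le ((le_algebraMap_iff_spectrum_le hsa).1 hb x hx) hr

/-- Truncating `Re b` first below at `0` and then above at `r` brings it closer to `a` in the
`2`-norm. -/
theorem exists_norm_le_trace_star_mul_self_sub_le (hτ : ∀ a b, τ (a * b) = τ (b * a)) {a : 𝔐}
    (ha : 0 ≤ a) (b : 𝔅) : ∃ c : 𝔅, ‖c‖ ≤ ‖a‖ ∧
      τ (star (a - ι c) * (a - ι c)) ≤ τ (star (a - ι b) * (a - ι b)) := by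
  set r := algebraMap ℝ 𝔅 ‖a‖ with hr
  have hιr : ι r = algebraMap ℝ 𝔐 ‖a‖ := by
    rw [hr, Algebra.algebraMap_eq_smul_one, ← Complex.coe_smul, map_smul, map_one, Complex.coe_smul,
      Algebra.algebraMap_eq_smul_one]
  have har : 0 ≤ ι r - a := by
    rw [hιr, sub_nonneg]
    exact ha.isSelfAdjoint.le_algebraMap_norm_self
  set u : 𝔅 := (ℜ b : 𝔅)
  have hu0 : 0 ≤ u⁺ := CFC.posPart_nonneg u
  have hr0 : 0 ≤ r := algebraMap_nonneg _ (norm_nonneg a)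
  refine ⟨r - (r - u⁺)⁺, ?_, ?_⟩
  · rw [CStarAlgebra.norm_le_iff_le_algebraMap _ (norm_nonneg a)
      (sub_nonneg.2 (posPart_le_algebraMap (norm_nonneg a) (sub_le_self _ hu0)))]
    exact sub_le_self _ (CFC.posPart_nonneg _)
  · have reflect (c : 𝔅) : star (a - ι c) * (a - ι c) =
        star ((ι r - a) - ι (r - c)) * ((ι r - a) - ι (r - c)) := by
      have : (ι r - a) - ι (r - c) = -(a - ι c) := by rw [map_sub]; abel
      rw [this, star_neg, neg_mul_neg]
    calc τ (star (a - ι (r - (r - u⁺)⁺)) * (a - ι (r - (r - u⁺)⁺)))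
        ≤ τ (star (a - ι u⁺) * (a - ι u⁺)) := by
          rw [reflect, sub_sub_cancel, reflect u⁺]
          exact trace_star_mul_self_sub_posPart_le hτ har (hr0.isSelfAdjoint.sub hu0.isSelfAdjoint)
      _ ≤ τ (star (a - ι u) * (a - ι u)) := trace_star_mul_self_sub_posPart_le hτ ha (ℜ b).2
      _ ≤ τ (star (a - ι b) * (a - ι b)) := by
          rw [trace_star_mul_self_sub hτ ha.isSelfAdjoint b]
          exact le_add_of_nonneg_right (map_nonneg τ (map_nonneg ι (star_mul_self_nonneg _)))

end Truncation

section NearestPoint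

variable {E : Type*} [NormedAddCommGroup E] [InnerProductSpace ℂ E]

theorem exists_mem_forall_inner_sub_eq_zero {K : Set E} {W : Submodule ℂ E} (hne : K.Nonempty)
    (hK : IsComplete K) (hconv : Convex ℝ K) (hKW : K ⊆ W) {u : E}
    (h : ∀ w ∈ W, ∃ k ∈ K, ‖u - k‖ ≤ ‖u - w‖) : ∃ v ∈ K, ∀ w ∈ W, ⟪u - v, w⟫_ℂ = 0 := by
  let := InnerProductSpace.rclikeToReal ℂ E
  obtain ⟨v, hv, hmin⟩ := exists_norm_eq_iInf_of_complete_convex hne hK hconv u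
  have bdd (S : Set E) : BddBelow (Set.range fun w : S => ‖u - w‖) :=
    ⟨0, Set.forall_mem_range.2 fun _ => norm_nonneg _⟩
  refine ⟨v, hv, (W.norm_eq_iInf_iff_inner_eq_zero (hKW hv)).1 (le_antisymm ?_ ?_)⟩
  · refine le_ciInf fun w => ?_
    obtain ⟨k, hk, hkw⟩ := h w w.2
    exact hmin.trans_le ((ciInf_le (bdd K) ⟨k, hk⟩).trans hkw)
  · exact ciInf_le (bdd W) ⟨v, hKW hv⟩

end NearestPoint

section VonNeumann

variable {H : Type*} [NormedAddCommGroup H] [InnerProductSpace ℂ H] [CompleteSpace H]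

/-- The inclusion of a von Neumann subalgebra. -/
def inclusionHom {B M : VonNeumannAlgebra H} (hBM : B ≤ M) : B →⋆ₐ[ℂ] M where
  toFun := Set.inclusion hBM
  map_one' := rfl
  map_mul' _ _ := rfl
  map_zero' := rfl
  map_add' _ _ := rfl
  commutes' _ := rfl
  map_star' _ := rfl

variable {M B : VonNeumannAlgebra H} {τ : M →ₚ[ℂ] ℂ}

theorem exists_inner_orbit_eq (hτ : VonNeumannAlgebra.IsFaithfulNormalTraceState τ) :
    ∃ Ξ : lp (fun _ : ℕ => H) 2, ∀ a b : M, ⟪orbit Ξ a, orbit Ξ b⟫_ℂ = τ (star a * b) := by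
  obtain ⟨ξ, hξ, hsum⟩ := hτ.normal
  refine ⟨⟨ξ, memℓp_gen (by simpa using hξ)⟩, fun a b => ?_⟩
  refine (lp.hasSum_inner _ _).unique ((hsum (star a * b)).congr_fun fun k => ?_)
  change _ = ⟪ξ k, (star (a : H →L[ℂ] H)) ((b : H →L[ℂ] H) (ξ k))⟫_ℂ
  rw [ContinuousLinearMap.star_eq_adjoint, ContinuousLinearMap.adjoint_inner_right]
  rfl

theorem eq_zero_of_forall_apply_eq_zero (hτ : VonNeumannAlgebra.IsFaithfulNormalTraceState τ)
    {Ξ : lp (fun _ : ℕ => H) 2} (hΞ : ∀ a b : M, ⟪orbit Ξ a, orbit Ξ b⟫_ℂ = τ (star a * b))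
    {a : H →L[ℂ] H} (ha : a ∈ M) (h0 : ∀ k, a (Ξ k) = 0) : a = 0 := by
  have horbit : orbit Ξ a = 0 := by ext k; exact h0 k
  have := hτ.faithful ⟨a, ha⟩ (by rw [← hΞ, horbit, inner_zero_left])
  exact congrArg Subtype.val this

theorem convex_orbit_ball (B : VonNeumannAlgebra H) (Ξ : lp (fun _ : ℕ => H) 2) (r : ℝ) :
    Convex ℝ (orbit Ξ '' {b | b ∈ B ∧ ‖b‖ ≤ r}) := by
  have hball : Convex ℝ {b : H →L[ℂ] H | ‖b‖ ≤ r} := by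
    simpa [Metric.closedBall] using convex_closedBall (0 : H →L[ℂ] H) r
  exact ((B.toStarSubalgebra.toSubalgebra.toSubmodule.restrictScalars ℝ).convex.inter
    hball).linear_image ((orbit Ξ).restrictScalars ℝ)

/-- `y` is the point of the ball of radius `‖a‖` of `B` closest to `a` in the `2`-norm. Unlike `B`,
this ball is closed in the `2`-norm, and by truncation no point of `B` is closer to `a`. -/
theorem exists_trace_mul_eq_of_nonneg (hτ : VonNeumannAlgebra.IsFaithfulNormalTraceState τ)
    (hBM : B ≤ M) {a : M} (ha : 0 ≤ a) :
    ∃ y : B, ∀ b, τ (inclusionHom hBM y * inclusionHom hBM b) = τ (a * inclusionHom hBM b) := by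
  obtain ⟨Ξ, hΞ⟩ := exists_inner_orbit_eq hτ
  set K := orbit Ξ '' {b | b ∈ B ∧ ‖b‖ ≤ ‖a‖}
  set W := B.toStarSubalgebra.toSubalgebra.toSubmodule.map (orbit Ξ)
  have hclosed : IsClosed K := isClosed_orbit_ball
    (fun b hb => eq_zero_of_forall_apply_eq_zero hτ hΞ (hBM hb)) _
  have inner_sub (b : B) (c : M) : ⟪orbit Ξ a - orbit Ξ b, orbit Ξ c⟫_ℂ =
      τ (star (a - inclusionHom hBM b) * c) := by
    rw [← map_sub]; exact hΞ (a - inclusionHom hBM b) c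
  have norm_sub (b : B) : (‖orbit Ξ a - orbit Ξ b‖ : ℂ) ^ 2 =
      τ (star (a - inclusionHom hBM b) * (a - inclusionHom hBM b)) := by
    have hsub : orbit Ξ ↑(a - inclusionHom hBM b) = orbit Ξ a - orbit Ξ b := map_sub _ _ _
    rw [← inner_sub, hsub]
    exact (inner_self_eq_norm_sq_to_K (𝕜 := ℂ) (orbit Ξ a - orbit Ξ b)).symm
  have hnear : ∀ w ∈ W, ∃ k ∈ K, ‖orbit Ξ a - k‖ ≤ ‖orbit Ξ a - w‖ := by
    rintro _ ⟨b, hb, rfl⟩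
    obtain ⟨c, hca, hcb⟩ :=
      exists_norm_le_trace_star_mul_self_sub_le (ι := inclusionHom hBM) hτ.trace ha ⟨b, hb⟩
    rw [← norm_sub, ← norm_sub] at hcb
    exact ⟨_, ⟨c, ⟨c.2, hca⟩, rfl⟩, le_of_sq_le_sq (by exact_mod_cast hcb) (norm_nonneg _)⟩
  have hne : K.Nonempty := ⟨_, 0, ⟨zero_mem B, by simp⟩, rfl⟩
  obtain ⟨_, ⟨y, ⟨hy, -⟩, rfl⟩, horth⟩ := exists_mem_forall_inner_sub_eq_zero
    hne hclosed.isComplete (convex_orbit_ball B Ξ _)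
    (Set.image_mono fun b hb => hb.1) hnear
  refine ⟨⟨y, hy⟩, fun b => ?_⟩
  have h0 : τ (star (a - inclusionHom hBM ⟨y, hy⟩) * inclusionHom hBM (star b)) = 0 := by
    rw [← inner_sub]
    exact horth _ ⟨_, (star b).2, rfl⟩
  have := congrArg star h0
  rw [← map_star, star_mul, star_star, map_star, star_star, hτ.trace, star_zero, sub_mul, map_sub,
    sub_eq_zero] at this
  exact this.symm

theorem exists_isTracialCondExp (hτ : VonNeumannAlgebra.IsFaithfulNormalTraceState τ)
    (hBM : B ≤ M) : ∃ E : M →ₗ[ℂ] B, IsTracialCondExp (inclusionHom hBM) τ E := by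
  have hexists (a : M) : ∃ y : B, ∀ b,
      τ (inclusionHom hBM y * inclusionHom hBM b) = τ (a * inclusionHom hBM b) := by
    have ha : a ∈ Submodule.span ℂ {a : M | 0 ≤ a} := by
      rw [CStarAlgebra.span_nonneg]; trivial
    induction ha using Submodule.span_induction with
    | mem a ha => exact exists_trace_mul_eq_of_nonneg hτ hBM ha
    | zero => exact ⟨0, by simp⟩
    | add a b _ _ ha hb =>
      obtain ⟨y, hy⟩ := ha
      obtain ⟨z, hz⟩ := hb
      exact ⟨y + z, fun c => by simp only [map_add, add_mul, hy, hz]⟩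
    | smul r a _ ha =>
      obtain ⟨y, hy⟩ := ha
      exact ⟨r • y, fun c => by simp only [map_smul, smul_mul_assoc, hy]⟩
  have faithful (b : B) (h : τ (inclusionHom hBM (star b * b)) = 0) : b = 0 :=
    Subtype.ext (congrArg (fun a : M => (a : H →L[ℂ] H)) (hτ.faithful (inclusionHom hBM b) h))
  have unique {y z : B} (h : ∀ b, τ (inclusionHom hBM y * inclusionHom hBM b) =
      τ (inclusionHom hBM z * inclusionHom hBM b)) : y = z := by
    refine sub_eq_zero.1 (faithful _ ?_)
    rw [map_mul, hτ.trace, map_sub, sub_mul, map_sub, h, sub_self]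
  choose E hE using hexists
  refine ⟨⟨⟨E, fun a b => unique fun c => ?_⟩, fun r a => unique fun c => ?_⟩,
    hτ.trace, faithful, hE⟩
  · simp only [map_add, add_mul, hE]
  · simp only [RingHom.id_apply, map_smul, smul_mul_assoc, hE]

/-- A functional `τ (y * ·)` is continuous in the `2`-norm, in which `A` is dense in its double
commutant. -/
theorem trace_mul_eq_zero_of_mem_generated
    (hτ : VonNeumannAlgebra.IsFaithfulNormalTraceState τ) {A : StarSubalgebra ℂ M} {y : M}
    (hy : ∀ m ∈ A, τ (y * m) = 0) {m : M}
    (hm : (m : H →L[ℂ] H) ∈ VonNeumannAlgebra.generated ((fun a : M => (a : H →L[ℂ] H)) '' A)) :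
    τ (y * m) = 0 := by
  obtain ⟨Ξ, hΞ⟩ := exists_inner_orbit_eq hτ
  set A' : StarSubalgebra ℂ (H →L[ℂ] H) := A.map M.toStarSubalgebra.subtype
  have hm' : (m : H →L[ℂ] H) ∈ Set.centralizer (Set.centralizer (A' : Set (H →L[ℂ] H))) := by
    have hstar : star (A' : Set (H →L[ℂ] H)) = A' := by ext; simp
    have h : (m : H →L[ℂ] H) ∈ (StarSubalgebra.centralizer ℂ
      (StarSubalgebra.centralizer ℂ (A' : Set (H →L[ℂ] H)) : Set (H →L[ℂ] H)) :
        Set (H →L[ℂ] H)) := hm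
    rwa [StarSubalgebra.coe_centralizer_centralizer, hstar, Set.union_self] at h
  have inner_eq (a : M) : ⟪orbit Ξ (star y : M), orbit Ξ a⟫_ℂ = τ (y * a) := by
    rw [hΞ, star_star]
  have hclosed : IsClosed {f | ⟪orbit Ξ (star y : M), f⟫_ℂ = 0} :=
    isClosed_eq (by fun_prop) continuous_const
  rw [← inner_eq]
  refine closure_minimal ?_ hclosed (orbit_mem_closure A' Ξ hm')
  rintro _ ⟨_, ⟨a, ha, rfl⟩, rfl⟩
  exact (inner_eq a).trans (hy a ha)

end VonNeumann

/-! ### Matrix amplification -/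

section MatrixEntries

variable {K : Type*} [Ring K] {n : ℕ}

theorem amplify_apply {K : Type*} [Zero K] (x : K) (i j : Fin n) :
    amplify n x i j = if i = j then x else 0 := rfl

theorem amplify_mul_apply (x : K) (T : CStarMatrix (Fin n) (Fin n) K) (i j : Fin n) :
    (amplify n x * T) i j = x * T i j :=
  Matrix.diagonal_mul _ _ _ _

theorem mul_amplify_apply (x : K) (T : CStarMatrix (Fin n) (Fin n) K) (i j : Fin n) :
    (T * amplify n x) i j = T i j * x :=
  Matrix.mul_diagonal _ _ _ _

theorem amplify_mem_matricesOver {S : Type*} [SetLike S K] [ZeroMemClass S K] {s : S} {x : K}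
    (hx : x ∈ s) : amplify n x ∈ matricesOver n (s : Set K) := fun i j => by
  rw [amplify_apply]
  split_ifs
  exacts [hx, zero_mem s]

variable [Algebra ℂ K]

theorem matrixFunctional_apply (φ : K →ₗ[ℂ] ℂ) (T : CStarMatrix (Fin n) (Fin n) K) :
    matrixFunctional φ n T = (n : ℂ)⁻¹ * ∑ i, φ (T i i) := rfl

theorem matrixFunctional_mul (φ : K →ₗ[ℂ] ℂ) (S T : CStarMatrix (Fin n) (Fin n) K) :
    matrixFunctional φ n (S * T) = (n : ℂ)⁻¹ * ∑ i, ∑ k, φ (S i k * T k i) := by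
  simp only [matrixFunctional_apply, CStarMatrix.mul_apply, map_sum]

theorem matrixFunctional_mul_single (φ : K →ₗ[ℂ] ℂ) (S : CStarMatrix (Fin n) (Fin n) K)
    (i j : Fin n) (x : K) :
    matrixFunctional φ n (S * CStarMatrix.ofMatrix (Matrix.single j i x)) =
      (n : ℂ)⁻¹ * φ (S i j * x) := by
  rw [matrixFunctional_mul, Finset.sum_eq_single i, Finset.sum_eq_single j]
  · simp
  · intro k _ hk
    simp [hk.symm]
  · simp
  · intro k _ hk
    simp [hk.symm]
  · simp

/-- `𝔐_n(𝒬)` for a subspace `𝒬`. -/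
def matrixSubmodule (n : ℕ) (𝒬 : Submodule ℂ K) :
    Submodule ℂ (CStarMatrix (Fin n) (Fin n) K) where
  carrier := matricesOver n 𝒬
  add_mem' hS hT i j := 𝒬.add_mem (hS i j) (hT i j)
  zero_mem' _ _ := 𝒬.zero_mem
  smul_mem' c _ hT i j := 𝒬.smul_mem c (hT i j)

end MatrixEntries

section MatrixStarAlgebra

variable {K L : Type*} [Ring K] [StarRing K] [Algebra ℂ K] [Ring L] [StarRing L] [Algebra ℂ L]
  {n : ℕ}

/-- `x ↦ x ⊗ I_n` as a `⋆`-homomorphism. -/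
def amplifyHom (n : ℕ) (K : Type*) [Ring K] [StarRing K] [Algebra ℂ K] :
    K →⋆ₐ[ℂ] CStarMatrix (Fin n) (Fin n) K where
  toFun := amplify n
  map_one' := Matrix.diagonal_one
  map_mul' _ _ := (Matrix.diagonal_mul_diagonal' _ _).symm
  map_zero' := Matrix.diagonal_zero
  map_add' _ _ := (Matrix.diagonal_add _ _).symm
  commutes' _ := rfl
  map_star' _ := (Matrix.diagonal_conjTranspose _).symm

@[simp]
theorem amplifyHom_apply (x : K) : amplifyHom n K x = amplify n x := rfl

/-- Entrywise application of a `⋆`-homomorphism. -/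
def matrixHom (n : ℕ) (ι : K →⋆ₐ[ℂ] L) :
    CStarMatrix (Fin n) (Fin n) K →⋆ₐ[ℂ] CStarMatrix (Fin n) (Fin n) L :=
  { CStarMatrix.mapₙₐ (ι : K →⋆ₙₐ[ℂ] L) with
    map_one' := Matrix.map_one ι (map_zero ι) (map_one ι)
    commutes' := fun r => Matrix.map_algebraMap r ι (map_zero ι) (AlgHomClass.commutes ι r) }

@[simp]
theorem matrixHom_apply (ι : K →⋆ₐ[ℂ] L) (T : CStarMatrix (Fin n) (Fin n) K) (i j : Fin n) :
    matrixHom n ι T i j = ι (T i j) := rfl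

/-- `𝔐_n(C)` for a `⋆`-subalgebra `C`. -/
def matrixStarSubalgebra [StarModule ℂ K] (n : ℕ) (C : StarSubalgebra ℂ K) :
    StarSubalgebra ℂ (CStarMatrix (Fin n) (Fin n) K) where
  carrier := matricesOver n C
  mul_mem' hS hT i j := by
    rw [CStarMatrix.mul_apply]
    exact sum_mem fun k _ => mul_mem (hS i k) (hT k j)
  add_mem' hS hT i j := add_mem (hS i j) (hT i j)
  algebraMap_mem' r := amplify_mem_matricesOver (C.algebraMap_mem r)
  star_mem' hT i j := star_mem (hT j i)

end MatrixStarAlgebra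

section MatrixSetting

theorem isClosed_matricesOver {K : Type*} [NonUnitalCStarAlgebra K] {n : ℕ} {s : Set K}
    (hs : IsClosed s) : IsClosed (matricesOver n s) := by
  have continuous_entry (i j : Fin n) :
      Continuous fun T : CStarMatrix (Fin n) (Fin n) K => T i j :=
    (continuous_apply j).comp (continuous_apply (A := fun _ => Fin n → K) i)
  simp only [matricesOver, Set.ofPred_forall]
  exact isClosed_iInter fun i => isClosed_iInter fun j => hs.preimage (continuous_entry i j)

theorem map_nonneg_of_map_star_mul_self_nonneg {A : Type*} [CStarAlgebra A] [PartialOrder A]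
    [StarOrderedRing A] {φ : A →ₗ[ℂ] ℂ} (hφ : ∀ a, 0 ≤ φ (star a * a)) {a : A} (ha : 0 ≤ a) :
    0 ≤ φ a := by
  obtain ⟨s, rfl⟩ := CStarAlgebra.nonneg_iff_eq_star_mul_self.1 ha
  exact hφ s

variable {𝔐 𝔅 : Type*} [CStarAlgebra 𝔐] [PartialOrder 𝔐] [StarOrderedRing 𝔐]
  [CStarAlgebra 𝔅] [PartialOrder 𝔅] [StarOrderedRing 𝔅]

/-- `τ ⊗ tr_n` as a positive functional. -/
noncomputable def matrixTrace (n : ℕ) (τ : 𝔐 →ₚ[ℂ] ℂ) : CStarMatrix (Fin n) (Fin n) 𝔐 →ₚ[ℂ] ℂ :=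
  .mk₀ (matrixFunctional τ.toLinearMap n) fun _ =>
    map_nonneg_of_map_star_mul_self_nonneg fun T => by
    rw [matrixFunctional_mul]
    exact mul_nonneg (by positivity) (Finset.sum_nonneg fun i _ => Finset.sum_nonneg fun k _ =>
      map_nonneg τ (star_mul_self_nonneg (T k i)))

theorem matrixTrace_apply {n : ℕ} (τ : 𝔐 →ₚ[ℂ] ℂ) (T : CStarMatrix (Fin n) (Fin n) 𝔐) :
    matrixTrace n τ T = matrixFunctional τ.toLinearMap n T := rfl

theorem matrixTrace_mul {n : ℕ} (τ : 𝔐 →ₚ[ℂ] ℂ) (S T : CStarMatrix (Fin n) (Fin n) 𝔐) :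
    matrixTrace n τ (S * T) = (n : ℂ)⁻¹ * ∑ i, ∑ k, τ (S i k * T k i) :=
  matrixFunctional_mul τ.toLinearMap S T

variable {ι : 𝔅 →⋆ₐ[ℂ] 𝔐} {τ : 𝔐 →ₚ[ℂ] ℂ} {E : 𝔐 →ₗ[ℂ] 𝔅} {P : 𝔐} {α : ℝ}

theorem IsTracialCondExp.matrix (hE : IsTracialCondExp ι τ E) (n : ℕ) :
    IsTracialCondExp (matrixHom n ι) (matrixTrace n τ) (CStarMatrix.mapₗ E) where
  trace_comm S T := by
    rw [matrixTrace_mul, matrixTrace_mul, Finset.sum_comm]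
    simp only [hE.trace_comm]
  faithful T hT := by
    ext i j
    have hn : (n : ℂ)⁻¹ ≠ 0 := inv_ne_zero (Nat.cast_ne_zero.2 (Fin.pos i).ne')
    have nonneg (k l : Fin n) : 0 ≤ τ (ι (star (T l k) * T l k)) :=
      map_nonneg τ (map_nonneg ι (star_mul_self_nonneg _))
    have hsum : ∑ k, ∑ l, τ (ι (star (T l k) * T l k)) = 0 := by
      rw [map_mul, matrixTrace_mul, mul_eq_zero, or_iff_right hn] at hT
      simpa only [map_mul, map_star, CStarMatrix.star_apply, matrixHom_apply] using hT
    have hcol := (Finset.sum_eq_zero_iff_of_nonneg fun k _ =>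
      Finset.sum_nonneg fun l _ => nonneg k l).1 hsum j (Finset.mem_univ _)
    exact hE.faithful _ ((Finset.sum_eq_zero_iff_of_nonneg fun l _ => nonneg j l).1 hcol i
      (Finset.mem_univ _))
  trace_condExp_mul S T := by
    rw [matrixTrace_mul, matrixTrace_mul]
    simp only [matrixHom_apply, CStarMatrix.mapₗ_apply, CStarMatrix.map_apply,
      hE.trace_condExp_mul]

theorem IsIndependentProjection.matrix (hP : IsIndependentProjection ι τ P α) (n : ℕ) :
    IsIndependentProjection (matrixHom n ι) (matrixTrace n τ) (amplify n P) α where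
  isStarProjection := hP.isStarProjection.map (amplifyHom n 𝔐)
  commute T := by
    ext i j
    rw [amplify_mul_apply, mul_amplify_apply, matrixHom_apply, (hP.commute _).eq]
  trace_mul T := by
    simp only [matrixTrace_apply, matrixFunctional_apply, amplify_mul_apply, matrixHom_apply,
      PositiveLinearMap.coe_toLinearMap, hP.trace_mul, ← Finset.mul_sum]
    ring
  pos := hP.pos
  le_one := hP.le_one

theorem IsCompressionSetting.matrix {C : StarSubalgebra ℂ 𝔐} {𝒬 : Submodule ℂ 𝔐}
    (hS : IsCompressionSetting ι τ E P α C 𝒬) (n : ℕ) :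
    IsCompressionSetting (matrixHom n ι) (matrixTrace n τ) (CStarMatrix.mapₗ E) (amplify n P) α
      (matrixStarSubalgebra n C) (matrixSubmodule n 𝒬) := by
  have centered : amplify n P - (α : ℂ) • 1 = amplify n (P - (α : ℂ) • 1) := by
    simp only [← amplifyHom_apply, map_sub, map_smul, map_one]
  exact
    { toIsTracialCondExp := hS.toIsTracialCondExp.matrix n
      toIsIndependentProjection := hS.toIsIndependentProjection.matrix n
      isClosed_subalgebra := isClosed_matricesOver hS.isClosed_subalgebra
      map_mem := fun T i j => hS.map_mem (T i j)
      isClosed_submodule := isClosed_matricesOver hS.isClosed_submodule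
      proj_sub_mem := by
        rw [centered]
        exact amplify_mem_matricesOver hS.proj_sub_mem
      proj_sub_mul_mem := fun w hw v hv hEv i j => by
        rw [centered, CStarMatrix.mul_apply]
        refine 𝒬.sum_mem fun k _ => ?_
        rw [amplify_mul_apply]
        exact hS.proj_sub_mul_mem _ (hw k j) _ (hv i k) (congrFun₂ hEv i k)
      trace_mul_eq_zero := fun w hw m hm => by
        rw [matrixTrace_mul, Finset.sum_eq_zero, mul_zero]
        exact fun i _ => Finset.sum_eq_zero fun k _ =>
          hS.trace_mul_eq_zero _ (hw i k) _ (hm k i) }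

end MatrixSetting

/-! ### Alternating products -/

section AlternatingProducts

variable {K : Type*} [Ring K] [Algebra ℂ K]

/-- `w` is an alternating product of elements of the algebras `S i` that are centered over `A`,
with first factor in `S i`. -/
inductive IsAlternatingProduct {κ : Type*} (φ : K →ₗ[ℂ] ℂ) (A : Subalgebra ℂ K)
    (S : κ → Subalgebra ℂ K) : κ → K → Prop
  | single {i : κ} {a : K} : a ∈ S i → IsCondExp φ A a 0 → IsAlternatingProduct φ A S i a
  | cons {i j : κ} {a w : K} : i ≠ j → a ∈ S i → IsCondExp φ A a 0 →
      IsAlternatingProduct φ A S j w → IsAlternatingProduct φ A S i (a * w)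

variable {κ : Type*} {φ : K →ₗ[ℂ] ℂ} {A : Subalgebra ℂ K} {S : κ → Subalgebra ℂ K}

theorem IsAlternatingProduct.exists_prod_ofFn_eq {i : κ} {w : K}
    (hw : IsAlternatingProduct φ A S i w) :
    ∃ (k : ℕ) (j : Fin (k + 1) → κ) (a : Fin (k + 1) → K), j 0 = i ∧ (∀ l, a l ∈ S (j l)) ∧
      (∀ l : Fin k, j l.castSucc ≠ j l.succ) ∧ (∀ l, IsCondExp φ A (a l) 0) ∧
      (List.ofFn a).prod = w := by
  induction hw with
  | @single i a ha ha0 =>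
    exact ⟨0, fun _ => i, fun _ => a, rfl, fun _ => ha, fun l => l.elim0, fun _ => ha0, by simp⟩
  | @cons i _ a _ hne ha ha0 _ ih =>
    obtain ⟨k, j, b, rfl, hmem, halt, hcentered, rfl⟩ := ih
    refine ⟨k + 1, Fin.cons i j, Fin.cons a b, rfl, Fin.cases ha hmem, Fin.cases hne halt,
      Fin.cases ha0 hcentered, ?_⟩
    rw [List.ofFn_cons, List.prod_cons]

theorem IsFreeOver.isCondExp_zero (h : IsFreeOver φ A S) {i : κ} {w : K}
    (hw : IsAlternatingProduct φ A S i w) : IsCondExp φ A w 0 := by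
  obtain ⟨k, j, a, -, hmem, halt, hcentered, rfl⟩ := hw.exists_prod_ofFn_eq
  exact h k j a hmem halt hcentered

end AlternatingProducts

section StarPolys

variable {K : Type*} [Ring K] [Algebra ℂ K] {A : Subalgebra ℂ K} {X : K}

theorem le_polys : A ≤ polys A X :=
  fun _ ha => Algebra.subset_adjoin (Or.inl ha)

variable [StarRing K] [StarModule ℂ K]

theorem star_mem_polys (hA : ∀ a ∈ A, star a ∈ A) (hX : IsSelfAdjoint X) {m : K}
    (hm : m ∈ polys A X) : star m ∈ polys A X := by
  induction hm using Algebra.adjoin_induction with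
  | mem x hx =>
    rcases hx with hx | rfl
    · exact le_polys (hA x hx)
    · rw [hX.star_eq]
      exact mem_polys_self A _
  | algebraMap r =>
    rw [← algebraMap_star_comm]
    exact Subalgebra.algebraMap_mem _ _
  | add x y _ _ hx hy =>
    rw [star_add]
    exact add_mem hx hy
  | mul x y _ _ hx hy =>
    rw [star_mul]
    exact mul_mem hy hx

/-- `A⟨X⟩` as a `⋆`-subalgebra, for a `⋆`-closed `A` and a self-adjoint `X`. -/
def starPolys (hA : ∀ a ∈ A, star a ∈ A) (hX : IsSelfAdjoint X) : StarSubalgebra ℂ K :=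
  { polys A X with star_mem' := star_mem_polys hA hX }

end StarPolys

section VonNeumannSetting

variable {H : Type*} [NormedAddCommGroup H] [InnerProductSpace ℂ H] [CompleteSpace H]
  {M B : VonNeumannAlgebra H} {τ : M →ₚ[ℂ] ℂ} {hBM : B ≤ M} {E : M →ₗ[ℂ] B} {X p : M}

theorem star_mem_within (B M : VonNeumannAlgebra H) : ∀ a ∈ B.within M, star a ∈ B.within M :=
  fun _ ha => star_mem (s := B) ha

theorem inclusionHom_mem_within (hBM : B ≤ M) (b : B) : inclusionHom hBM b ∈ B.within M := b.2

theorem isCondExp_zero_iff (hBM : B ≤ M) {a : M} : IsCondExp τ.toLinearMap (B.within M) a 0 ↔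
    ∀ b : B, τ (a * inclusionHom hBM b) = 0 := by
  have zero_eq (b : M) : τ.toLinearMap (0 * b) = 0 := by rw [zero_mul, map_zero]
  exact ⟨fun h b => ((h.2 _ (inclusionHom_mem_within hBM b)).symm.trans (zero_eq _)),
    fun h => ⟨zero_mem (B.within M), fun b hb => (zero_eq b).trans (h ⟨b, hb⟩).symm⟩⟩

theorem isCondExp_sub_condExp (hE : IsTracialCondExp (inclusionHom hBM) τ E) (m : M) :
    IsCondExp τ.toLinearMap (B.within M) (m - inclusionHom hBM (E m)) 0 :=
  (isCondExp_zero_iff hBM).2 fun b => by rw [sub_mul, map_sub, hE.trace_condExp_mul, sub_self]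

theorem trace_starProjection (hτ : VonNeumannAlgebra.IsFaithfulNormalTraceState τ)
    (hp : IsStarProjection p) (hp0 : p ≠ 0) :
    τ p = ((τ p).re : ℂ) ∧ 0 < (τ p).re ∧ (τ p).re ≤ 1 := by
  obtain ⟨hre, him⟩ := Complex.nonneg_iff.1 (map_nonneg τ hp.nonneg)
  have heq : τ p = ((τ p).re : ℂ) := Complex.ext rfl him.symm
  have hle : 0 ≤ τ (1 - p) := map_nonneg τ hp.one_sub.nonneg
  rw [map_sub, hτ.map_one, heq] at hle
  refine ⟨heq, hre.lt_of_ne fun h0 => hp0 (hτ.faithful p ?_), by exact_mod_cast sub_nonneg.1 hle⟩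
  rw [hp.isSelfAdjoint.star_eq, hp.isIdempotentElem.eq, heq, ← h0, Complex.ofReal_zero]

theorem isIndependentProjection (hτ : VonNeumannAlgebra.IsFaithfulNormalTraceState τ)
    (hp : IsStarProjection p) (hp0 : p ≠ 0)
    (hind : IsIndependentFrom τ.toLinearMap (B.within M) p) :
    IsIndependentProjection (inclusionHom hBM) τ p (τ p).re := by
  obtain ⟨heq, hpos, hle⟩ := trace_starProjection hτ hp hp0
  have hindep (b : B) := hind p (Algebra.subset_adjoin rfl) _ (inclusionHom_mem_within hBM b)
  refine ⟨hp, fun b => (hindep b).1, fun b => ?_, hpos, hle⟩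
  rw [← heq, (hindep b).1.eq, mul_comm]
  exact (hindep b).2

theorem isCondExp_proj_sub {α : ℝ} (hP : IsIndependentProjection (inclusionHom hBM) τ p α) :
    IsCondExp τ.toLinearMap (B.within M) (p - (α : ℂ) • 1) 0 :=
  (isCondExp_zero_iff hBM).2 fun b => by
    rw [sub_mul, map_sub, hP.trace_mul, smul_mul_assoc, one_mul, map_smul, smul_eq_mul, sub_self]

/-- The closed span of the alternating products of centered elements of `A⟨X⟩` and `A⟨p⟩` with
first factor in `A⟨p⟩`. -/
noncomputable def altSpan (τ : M →ₚ[ℂ] ℂ) (A : Subalgebra ℂ M) (X p : M) : Submodule ℂ M :=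
  (Submodule.span ℂ
    {w | IsAlternatingProduct τ.toLinearMap A ![polys A X, polys A p] 1 w}).topologicalClosure

theorem mul_mul_mem_altSpan {A : Subalgebra ℂ M} {q v w : M} (hq : q ∈ polys A p)
    (hq0 : IsCondExp τ.toLinearMap A q 0) (hv : v ∈ polys A X)
    (hv0 : IsCondExp τ.toLinearMap A v 0) (hw : w ∈ altSpan τ A X p) :
    q * v * w ∈ altSpan τ A X p := by
  refine map_mem_closure (continuous_const_mul (q * v)) hw fun x hx => ?_
  refine Submodule.span_le (p := (Submodule.span ℂ _).comap (LinearMap.mulLeft ℂ (q * v))).2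
    (fun y hy => Submodule.subset_span ?_) hx
  change IsAlternatingProduct _ _ _ _ (q * v * y)
  rw [mul_assoc]
  exact .cons one_ne_zero hq hq0 (.cons zero_ne_one hv hv0 hy)

theorem trace_alternatingProduct_mul_eq_zero (hE : IsTracialCondExp (inclusionHom hBM) τ E)
    (hfree : AreFreeOver τ.toLinearMap (B.within M) X p) {w m : M}
    (hw : IsAlternatingProduct τ.toLinearMap (B.within M)
      ![polys (B.within M) X, polys (B.within M) p] 1 w)
    (hm : m ∈ polys (B.within M) X) : τ (w * m) = 0 := by
  have hcentered : m - inclusionHom hBM (E m) ∈ polys (B.within M) X :=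
    sub_mem hm (le_polys (inclusionHom_mem_within hBM _))
  have h := (isCondExp_zero_iff hBM).1 (IsFreeOver.isCondExp_zero hfree
    (.cons zero_ne_one hcentered (isCondExp_sub_condExp hE m) hw)) 1
  rwa [map_one, mul_one, sub_mul, map_sub, hE.trace_comm _ w, hE.trace_comm _ w,
    (isCondExp_zero_iff hBM).1 (IsFreeOver.isCondExp_zero hfree hw) (E m), sub_zero] at h

theorem trace_mul_eq_zero_of_mem_altSpan (hE : IsTracialCondExp (inclusionHom hBM) τ E)
    (hfree : AreFreeOver τ.toLinearMap (B.within M) X p) {w m : M}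
    (hw : w ∈ altSpan τ (B.within M) X p) (hm : m ∈ closure (polys (B.within M) X : Set M)) :
    τ (w * m) = 0 := by
  have hτ : Continuous τ := map_continuous τ
  have hclosed_left (m : M) : IsClosed {w | τ (w * m) = 0} :=
    isClosed_eq (hτ.comp (continuous_mul_const m)) continuous_const
  have hclosed_right : IsClosed {m | τ (w * m) = 0} :=
    isClosed_eq (hτ.comp (continuous_const_mul w)) continuous_const
  refine closure_minimal (fun m hm => ?_) hclosed_right hm
  refine closure_minimal (fun w hw => ?_) (hclosed_left m) hw
  change w ∈ (τ.toLinearMap ∘ₗ LinearMap.mulRight ℂ m).ker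
  exact Submodule.span_le.2 (fun w hw => trace_alternatingProduct_mul_eq_zero hE hfree hw hm) hw

theorem isCompressionSetting (hE : IsTracialCondExp (inclusionHom hBM) τ E) {α : ℝ}
    (hP : IsIndependentProjection (inclusionHom hBM) τ p α) (hX : IsSelfAdjoint X)
    (hfree : AreFreeOver τ.toLinearMap (B.within M) X p) :
    IsCompressionSetting (inclusionHom hBM) τ E p α
      (starPolys (star_mem_within B M) hX).topologicalClosure
      (altSpan τ (B.within M) X p) := by
  have hq : p - (α : ℂ) • 1 ∈ polys (B.within M) p :=
    sub_mem (mem_polys_self _ p) (Subalgebra.smul_mem _ (one_mem _) _)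
  have hq0 := isCondExp_proj_sub hP
  exact
    { toIsTracialCondExp := hE
      toIsIndependentProjection := hP
      isClosed_subalgebra := isClosed_closure
      map_mem := fun b => subset_closure (le_polys (inclusionHom_mem_within hBM b))
      isClosed_submodule := isClosed_closure
      proj_sub_mem := subset_closure (Submodule.subset_span (.single hq hq0))
      proj_sub_mul_mem := fun w hw v hv hEv => by
        have hcont : Continuous fun v =>
            (p - (α : ℂ) • 1) * (v - inclusionHom hBM (E v)) * w :=
          (continuous_const.mul (continuous_id.sub
            ((map_continuous (inclusionHom hBM)).comp hE.continuous_condExp))).mul continuous_const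
        have hmem : (p - (α : ℂ) • 1) * (v - inclusionHom hBM (E v)) * w ∈
            altSpan τ (B.within M) X p := closure_minimal (fun v hv => mul_mul_mem_altSpan hq hq0
          (sub_mem hv (le_polys (inclusionHom_mem_within hBM (E v)))) (isCondExp_sub_condExp hE v)
          hw) (IsClosed.preimage hcont isClosed_closure) hv
        rwa [hEv, map_zero, sub_zero] at hmem
      trace_mul_eq_zero := fun w hw m hm => trace_mul_eq_zero_of_mem_altSpan hE hfree hw hm }

theorem polys_le_wstarPolys : polys (B.within M) X ≤ (wstarPolys B X).within M := by
  intro m hm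
  change (m : H →L[ℂ] H) ∈ (StarSubalgebra.centralizer ℂ (StarSubalgebra.centralizer ℂ
    ((fun a : M => (a : H →L[ℂ] H)) '' polys (B.within M) X) : Set (H →L[ℂ] H)) :
      Set (H →L[ℂ] H))
  rw [StarSubalgebra.coe_centralizer_centralizer]
  exact Set.subset_centralizer_centralizer (Or.inl ⟨m, hm, rfl⟩)

theorem closure_polys_subset_wstarPolys :
    closure (polys (B.within M) X : Set M) ⊆ (wstarPolys B X).within M :=
  closure_minimal polys_le_wstarPolys
    ((VonNeumannAlgebra.instIsClosed (wstarPolys B X)).preimage continuous_subtype_val)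

theorem matrixFunctional_mul_eq_zero_of_mem_wstarPolys
    (hτ : VonNeumannAlgebra.IsFaithfulNormalTraceState τ)
    (hX : IsSelfAdjoint X) {n : ℕ} {y : CStarMatrix (Fin n) (Fin n) M}
    (hy : ∀ m ∈ matricesOver n (polys (B.within M) X : Set M),
      matrixFunctional τ.toLinearMap n (y * m) = 0)
    {m : CStarMatrix (Fin n) (Fin n) M}
    (hm : m ∈ matricesOver n ((wstarPolys B X).within M : Set M)) :
    matrixFunctional τ.toLinearMap n (y * m) = 0 := by
  have entry_orthogonal (i j : Fin n) (d : M) (hd : d ∈ polys (B.within M) X) :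
      τ (y i j * d) = 0 := by
    have hn : (n : ℂ)⁻¹ ≠ 0 := inv_ne_zero (Nat.cast_ne_zero.2 (Fin.pos i).ne')
    have h := hy (CStarMatrix.ofMatrix (Matrix.single j i d)) fun k l => by
      rw [CStarMatrix.ofMatrix_apply, Matrix.single_apply]
      split_ifs
      exacts [hd, zero_mem _]
    rw [matrixFunctional_mul_single] at h
    exact (mul_eq_zero.1 h).resolve_left hn
  rw [matrixFunctional_mul, Finset.sum_eq_zero, mul_zero]
  exact fun i _ => Finset.sum_eq_zero fun k _ =>
    trace_mul_eq_zero_of_mem_generated (A := starPolys (star_mem_within B M) hX) hτ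
      (entry_orthogonal i k) (hm k i)

theorem isCondExp_matricesOver_wstarPolys
    (hτ : VonNeumannAlgebra.IsFaithfulNormalTraceState τ) (hX : IsSelfAdjoint X) {n : ℕ}
    {R S : CStarMatrix (Fin n) (Fin n) M}
    (hS : S ∈ matricesOver n (closure (polys (B.within M) X : Set M)))
    (htrace : ∀ m ∈ matricesOver n (polys (B.within M) X : Set M),
      matrixFunctional τ.toLinearMap n (R * m) = matrixFunctional τ.toLinearMap n (S * m)) :
    IsCondExp (matrixFunctional τ.toLinearMap n)
      (matricesOver n ((wstarPolys B X).within M : Set M)) R S := by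
  refine ⟨fun i j => closure_polys_subset_wstarPolys (hS i j), fun m hm => ?_⟩
  rw [← sub_eq_zero, ← map_sub, ← sub_mul]
  refine matrixFunctional_mul_eq_zero_of_mem_wstarPolys hτ hX (fun d hd => ?_) hm
  rw [sub_mul, map_sub, htrace d hd, sub_self]

end VonNeumannSetting

end FreeCompression

theorem mainTheorem3_general {H : Type*} [NormedAddCommGroup H] [InnerProductSpace ℂ H]
    [CompleteSpace H] (M : VonNeumannAlgebra H) (τ : M →ₚ[ℂ] ℂ)
    (hτ : VonNeumannAlgebra.IsFaithfulNormalTraceState τ)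
    (B : VonNeumannAlgebra H) (hBM : B ≤ M)
    (X p : M) (hX : IsSelfAdjoint X) (hp : IsStarProjection p) (hp0 : p ≠ 0)
    (hfree : AreFreeOver τ.toLinearMap (B.within M) X p)
    (hind : IsIndependentFrom τ.toLinearMap (B.within M) p)
    (n : ℕ) :
    ∃ F : CStarMatrix (Fin n) (Fin n) B → CStarMatrix (Fin n) (Fin n) B,
      AnalyticOnNhd ℂ F (upperHalfPlane (CStarMatrix (Fin n) (Fin n) B)) ∧
      Set.MapsTo F (upperHalfPlane (CStarMatrix (Fin n) (Fin n) B))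
        (upperHalfPlane (CStarMatrix (Fin n) (Fin n) B)) ∧
      ∀ β ∈ upperHalfPlane (CStarMatrix (Fin n) (Fin n) B),
        ∃ R S : CStarMatrix (Fin n) (Fin n) M,
          IsCornerInverse (amplify n p)
            (amplify n ((τ p)⁻¹ • (p * X * p)) - β.map (Set.inclusion hBM) * amplify n p) R ∧
          (amplify n X - (F β).map (Set.inclusion hBM)) * S = 1 ∧
          S * (amplify n X - (F β).map (Set.inclusion hBM)) = 1 ∧
          IsCondExp (matrixFunctional τ.toLinearMap n)
            (matricesOver n ((wstarPolys B X).within M : Set M)) ((τ p)⁻¹ • R) S := by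
  obtain ⟨E, hE⟩ := exists_isTracialCondExp hτ hBM
  have hα := (trace_starProjection hτ hp hp0).1
  have hS := (isCompressionSetting hE (isIndependentProjection hτ hp hp0 hind) hX hfree).matrix n
  have hEn := hS.toIsTracialCondExp
  have hPn := hS.toIsIndependentProjection
  have hXn : IsSelfAdjoint (amplify n X) := hX.map (amplifyHom n M)
  have hXC : amplify n X ∈ matricesOver n (closure (polys (B.within M) X : Set M)) :=
    amplify_mem_matricesOver (s := (polys (B.within M) X).topologicalClosure)
      (subset_closure (mem_polys_self _ X))
  refine ⟨_, analyticOnNhd_subordination hEn hPn hXn,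
    fun β => subordination_mem_upperHalfPlane hEn hPn hXn, fun β hβ => ?_⟩
  have hu := isUnit_sub_subordination hEn hPn hXn hβ
  refine ⟨cornerResolvent (matrixHom n (inclusionHom hBM)) (amplify n p) (τ p).re (amplify n X) β,
    _, ?_, Ring.mul_inverse_cancel _ hu, Ring.inverse_mul_cancel _ hu,
    isCondExp_matricesOver_wstarPolys hτ hX (hS.subordinateResolvent_mem hXC) fun m hm => ?_⟩
  · have hcorner := isCornerInverse_cornerResolvent hPn.isStarProjection hPn.commute
      (τ p).re hXn hβ
    rw [← hα] at hcorner
    simp only [← amplifyHom_apply, map_smul, map_mul]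
    exact hcorner
  · rw [hα]
    exact hS.trace_cornerResolvent hXn hXC hβ fun i j => subset_closure (hm i j)

theorem mainTheorem3 {H : Type*} [NormedAddCommGroup H] [InnerProductSpace ℂ H] [CompleteSpace H]
    (M : VonNeumannAlgebra H) (τ : M →ₚ[ℂ] ℂ)
    (hτ : VonNeumannAlgebra.IsFaithfulNormalTraceState τ)
    (B : VonNeumannAlgebra H) (hBM : B ≤ M)
    (X p : M) (hX : IsSelfAdjoint X) (hp : IsStarProjection p) (hp0 : p ≠ 0)
    (hfree : AreFreeOver τ.toLinearMap (B.within M) X p)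
    (hind : IsIndependentFrom τ.toLinearMap (B.within M) p)
    (hJ : ∃ J : τ.GNS, IsL2ConjugateVariable τ B X J)
    (n : ℕ) :
    ∃ F : CStarMatrix (Fin n) (Fin n) B → CStarMatrix (Fin n) (Fin n) B,
      AnalyticOnNhd ℂ F (upperHalfPlane (CStarMatrix (Fin n) (Fin n) B)) ∧
      Set.MapsTo F (upperHalfPlane (CStarMatrix (Fin n) (Fin n) B))
        (upperHalfPlane (CStarMatrix (Fin n) (Fin n) B)) ∧
      ∀ β ∈ upperHalfPlane (CStarMatrix (Fin n) (Fin n) B),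
        ∃ R S : CStarMatrix (Fin n) (Fin n) M,
          -- `R` is the inverse of `X_p ⊗ I_n - β (p ⊗ I_n)` in `𝔐_n(pMp)`
          IsCornerInverse (amplify n p)
            (amplify n ((τ p)⁻¹ • (p * X * p)) - β.map (Set.inclusion hBM) * amplify n p) R ∧
          -- `S` is the inverse of `X ⊗ I_n - F(β)` in `𝔐_n(M)`
          (amplify n X - (F β).map (Set.inclusion hBM)) * S = 1 ∧
          S * (amplify n X - (F β).map (Set.inclusion hBM)) = 1 ∧
          -- `S = E(α⁻¹ R)`, with `E` the conditional expectation onto `𝔐_n(W*(B⟨X⟩))`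
          IsCondExp (matrixFunctional τ.toLinearMap n)
            (matricesOver n ((wstarPolys B X).within M : Set M)) ((τ p)⁻¹ • R) S :=
  mainTheorem3_general M τ hτ B hBM X p hX hp hp0 hfree hind n
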